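/- A two-colored graph is a finite undirected simple graph $G=(V,E)$ whose edge set is partitioned into a set $E_r$ of red edges and a set $E_b$ of blue edges; let $n=|V|$ and $m=|E|$. A bicolored $P_3$ in $G$ consists of three vertices $u,v,w$ with $\{u,v\}\in E_r$, $\{v,w\}\in E_b$ and $\{u,w\}\notin E$; the edges $\{u,v\}$ and $\{v,w\}$ are part of it. Bicolored $P_3$ Deletion (BPD) asks, given a two-colored graph $G$ and $k\in\mathbb N$, whether one can delete at most $k$ edges from $G$ such that the remaining graph contains no bicolored $P_3$. Three pairwise adjacent vertices form a bicolored $K_3$ if exactly two of the three edges between them have the same color; the bicolored $K_3$ is endangered in $G$ if at least one of these two edges is part of a bicolored $P_3$ in $G$. Theorem. BPD can be solved in $\mathcal O(n m^{3/2})$ time if $G$ contains no endangered bicolored $K_3$. Precisely: there are constants $c,C$ and one word-RAM program (words holding the numbers below $(n+m+k+2)^c$; unit-cost constants, copies, additions, truncated subtractions, multiplications, comparisons and random memory access) that, given $n$, $m$, $k$ and a list of the edges of $G$ with their colors, for every $k\in\mathbb N$ and every two-colored graph $G$ with vertex set $\{0,\dots,n-1\}$ and without endangered bicolored $K_3$ halts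 after at most $C\,(n\,m^{3/2}+1)$ steps and correctly decides whether $(G,k)$ is a yes-instance of BPD. -/

import Mathlib

/-- A two-colored graph `G = (V, E_r, E_b)`: a simple graph whose edge set is partitioned into
red and blue edges. -/
structure TwoColoredGraph (V : Type*) where
  red : SimpleGraph V
  blue : SimpleGraph V
  disjoint : Disjoint red blue

namespace TwoColoredGraph

variable {V : Type*}

/-- The uncolored graph with edge set `E = E_r ∪ E_b`. -/
def graph (G : TwoColoredGraph V) : SimpleGraph V := G.red ⊔ G.blue

/-- The number `m` of edges. -/
noncomputable def numEdges (G : TwoColoredGraph V) : ℕ := G.graph.edgeSet.ncard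

/-- The subgraph of `G` induced by `{u, v, w}` is a bicolored `P₃` with red edge `{u, v}` and
blue edge `{v, w}`. (The three vertices are then distinct, as the colors are disjoint.) -/
def IsBicoloredP3 (G : TwoColoredGraph V) (u v w : V) : Prop :=
  G.red.Adj u v ∧ G.blue.Adj v w ∧ ¬ G.graph.Adj u w

/-- `G` contains no bicolored `P₃` as an induced subgraph. -/
def BicoloredP3Free (G : TwoColoredGraph V) : Prop :=
  ∀ u v w, ¬ G.IsBicoloredP3 u v w

/-- The edge `e` is part of a bicolored `P₃` in `G`. -/
def PartOfBicoloredP3 (G : TwoColoredGraph V) (e : Sym2 V) : Prop :=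
  ∃ u v w, G.IsBicoloredP3 u v w ∧ (e = s(u, v) ∨ e = s(v, w))

/-- `u, v, w` form a bicolored `K₃` in which the two edges of the same color are `{u, v}` and
`{v, w}`, and `{u, w}` has the other color. -/
def IsBicoloredK3 (G : TwoColoredGraph V) (u v w : V) : Prop :=
  (G.red.Adj u v ∧ G.red.Adj v w ∧ G.blue.Adj u w) ∨
  (G.blue.Adj u v ∧ G.blue.Adj v w ∧ G.red.Adj u w)

/-- `u, v, w` form an endangered bicolored `K₃`: one of its two edges of the same color is part
of a bicolored `P₃` in `G`. -/
def IsEndangeredK3 (G : TwoColoredGraph V) (u v w : V) : Prop :=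
  G.IsBicoloredK3 u v w ∧ (G.PartOfBicoloredP3 s(u, v) ∨ G.PartOfBicoloredP3 s(v, w))

/-- The graph `G - S` obtained by deleting the edges in `S`. -/
def deleteEdges (G : TwoColoredGraph V) (S : Set (Sym2 V)) : TwoColoredGraph V where
  red := G.red.deleteEdges S
  blue := G.blue.deleteEdges S
  disjoint := G.disjoint.mono (SimpleGraph.deleteEdges_le S) (SimpleGraph.deleteEdges_le S)

/-- `(G, k)` is a yes-instance of Bicolored `P₃` Deletion: one can delete at most `k` edges of
`G` such that the remaining graph contains no bicolored `P₃` as induced subgraph. -/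
def IsYesInstanceBPD (G : TwoColoredGraph V) (k : ℕ) : Prop :=
  ∃ S : Finset (Sym2 V), (S : Set (Sym2 V)) ⊆ G.graph.edgeSet ∧ S.card ≤ k ∧
    (G.deleteEdges (S : Set (Sym2 V))).BicoloredP3Free

/-- `es` lists every edge of `G` exactly once, in any order, as a triple of its two endpoints
(in any order) and its color (`true` is red, `false` is blue). -/
def IsEdgeList (G : TwoColoredGraph V) (es : List (V × V × Bool)) : Prop :=
  (es.map fun e => s(e.1, e.2.1)).Nodup ∧
  (∀ u v, G.red.Adj u v ↔ (u, v, true) ∈ es ∨ (v, u, true) ∈ es) ∧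
  (∀ u v, G.blue.Adj u v ↔ (u, v, false) ∈ es ∨ (v, u, false) ∈ es)

end TwoColoredGraph

namespace WordRAM

/-- A memory configuration of a word RAM: natural-number registers, and random access arrays.
A program names its registers and arrays by constants, so that it uses finitely many of both
(the arrays can be interleaved into one memory at the cost of a constant factor). -/
structure State where
  reg : ℕ → ℕ
  mem : ℕ → ℕ → ℕ

/-- The state after writing `a` into register `d`. -/
def State.setReg (s : State) (d a : ℕ) : State :=
  { s with reg := Function.update s.reg d a }

/-- The state after writing `a` into cell `i` of array `b`. -/
def State.setMem (s : State) (b i a : ℕ) : State :=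
  { s with mem := Function.update s.mem b (Function.update (s.mem b) i a) }

/-- Programs of the word RAM. The letters `d x y` are numbers of registers, `b` is the number of
an array and `a` is a constant. -/
inductive Program where
  | skip
  | const (d a : ℕ)
  | copy (d x : ℕ)
  | add (d x y : ℕ)
  | sub (d x y : ℕ)
  | mul (d x y : ℕ)
  | load (d b x : ℕ)
  | store (b x y : ℕ)
  | seq (p q : Program)
  | ifLt (x y : ℕ) (p q : Program)
  | whileLt (x y : ℕ) (p : Program)

/-- `Exec B p s t s'`: on a machine whose words hold the numbers below `B`, program `p` started
in state `s` halts in state `s'` after exactly `t` steps. Every elementary operation and every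
evaluation of a test takes one step. A constant or a result of an arithmetic operation that does
not fit into a word has no execution, so that a run never overflows. -/
inductive Exec (B : ℕ) : Program → State → ℕ → State → Prop where
  | skip (s : State) : Exec B .skip s 1 s
  | const (s : State) (d a : ℕ) (h : a < B) :
      Exec B (.const d a) s 1 (s.setReg d a)
  | copy (s : State) (d x : ℕ) :
      Exec B (.copy d x) s 1 (s.setReg d (s.reg x))
  | add (s : State) (d x y : ℕ) (h : s.reg x + s.reg y < B) :
      Exec B (.add d x y) s 1 (s.setReg d (s.reg x + s.reg y))
  | sub (s : State) (d x y : ℕ) :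
      Exec B (.sub d x y) s 1 (s.setReg d (s.reg x - s.reg y))
  | mul (s : State) (d x y : ℕ) (h : s.reg x * s.reg y < B) :
      Exec B (.mul d x y) s 1 (s.setReg d (s.reg x * s.reg y))
  | load (s : State) (d b x : ℕ) :
      Exec B (.load d b x) s 1 (s.setReg d (s.mem b (s.reg x)))
  | store (s : State) (b x y : ℕ) :
      Exec B (.store b x y) s 1 (s.setMem b (s.reg x) (s.reg y))
  | seq {p q : Program} {s s₁ s₂ : State} {t₁ t₂ : ℕ}
      (hp : Exec B p s t₁ s₁) (hq : Exec B q s₁ t₂ s₂) :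
      Exec B (.seq p q) s (t₁ + t₂) s₂
  | ifLt_true {x y : ℕ} {p q : Program} {s s₁ : State} {t : ℕ}
      (h : s.reg x < s.reg y) (hp : Exec B p s t s₁) :
      Exec B (.ifLt x y p q) s (1 + t) s₁
  | ifLt_false {x y : ℕ} {p q : Program} {s s₁ : State} {t : ℕ}
      (h : ¬ s.reg x < s.reg y) (hq : Exec B q s t s₁) :
      Exec B (.ifLt x y p q) s (1 + t) s₁
  | whileLt_true {x y : ℕ} {p : Program} {s s₁ s₂ : State} {t₁ t₂ : ℕ}
      (h : s.reg x < s.reg y) (hp : Exec B p s t₁ s₁)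
      (hw : Exec B (.whileLt x y p) s₁ t₂ s₂) :
      Exec B (.whileLt x y p) s (1 + t₁ + t₂) s₂
  | whileLt_false {x y : ℕ} {p : Program} {s : State}
      (h : ¬ s.reg x < s.reg y) :
      Exec B (.whileLt x y p) s 1 s

/-- The initial state for the instance `(G, k)`, where `G` has the vertices `0, …, n - 1` and the
edge list `es`. Registers `0, 1, 2` hold `n`, `m` and `k`; arrays `0, 1, 2` hold at index
`i < m` the two endpoints and the color (red is `1`, blue is `0`) of the `i`-th edge. All else
is `0`. -/
def inputBPD {n : ℕ} (es : List (Fin n × Fin n × Bool)) (k : ℕ) : State where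
  reg
    | 0 => n
    | 1 => es.length
    | 2 => k
    | _ => 0
  mem b i :=
    match b, es[i]? with
    | 0, some (u, _, _) => u
    | 1, some (_, v, _) => v
    | 2, some (_, _, isRed) => if isRed then 1 else 0
    | _, _ => 0

end WordRAM

/-!
Join a red and a blue edge of `G` if they form a bicolored `P₃`. This conflict graph is bipartite,
with the red edges as left and the blue edges as right vertices. A solution is a vertex cover of
it, and conversely deleting a vertex cover that consists of conflicting edges leaves no bicolored
`P₃`: a new one would come from a bicolored `K₃` whose deleted edge is one of its two edges of
equal color, and this edge has a conflict, so that the `K₃` is endangered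
(`HasCover.isYesInstance`). Hence `(G, k)` is a yes-instance if and only if the conflict graph
has a vertex cover of at most `k` vertices, that is, if its maximum matchings have at most `k`
edges.

A maximum matching is found by an auction. Each blue edge has a price, at first `0`. An unmatched
red edge takes its cheapest neighbor, whose price rises by `1`, and the former mate of this
neighbor continues. A red edge whose neighbors all have the price `L` is stuck, and then the last
exchange is undone. Every mate is cheapest up to `1` (`PassInv.slack`), so that for each `j ≤ L`
the blue edges of price at least `j`, together with the red edges that have a cheaper neighbor,
are a vertex cover that exceeds the matching by at most the number of blue edges of price exactly
`j` (`PassInv.hasCover_level`). Some level has at most `m / L` of them; and if no red edge could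
be added to the matching, then the owners of the price `L` are all stuck, and the cover for
`j = L` proves that the matching is maximum.

For `L = ⌈√m⌉` one such pass makes at most `m L` bids, each found in time `O(n)`
(`potential`, `pass_wp`), and leaves a matching at most `L` below the maximum. Each further pass
with price limit `1`, which is a depth-first search for augmenting paths, takes time `O(n m)` and
enlarges the matching or proves that it is maximum. The sum is `O(n m √m)` (`totalCost_le`).
Correctness and running time of the program are shown together, in a program logic with time
credits (`Wp`).
-/

/-! ### Time credits for the word RAM -/

namespace WordRAM

@[simp] theorem State.setReg_reg (s : State) (d a r : ℕ) :
    (s.setReg d a).reg r = if r = d then a else s.reg r := by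
  simp [State.setReg, Function.update_apply]

@[simp] theorem State.setReg_mem (s : State) (d a : ℕ) : (s.setReg d a).mem = s.mem := rfl

@[simp] theorem State.setMem_reg (s : State) (b i a : ℕ) : (s.setMem b i a).reg = s.reg := rfl

@[simp] theorem State.setMem_mem (s : State) (b i a b' : ℕ) :
    (s.setMem b i a).mem b' = if b' = b then Function.update (s.mem b) i a else s.mem b' := by
  by_cases h : b' = b
  · subst h; simp [State.setMem]
  · simp [State.setMem, h]

infixr:60 " ;; " => Program.seq

/-- Started in state `s` with `c` time credits, the program `p` halts, pays one credit for each
step, and the final state together with some of the credits left over satisfies `Q`. -/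
def Wp (B : ℕ) (p : Program) (Q : State → ℕ → Prop) (s : State) (c : ℕ) : Prop :=
  ∃ t s' c', Exec B p s t s' ∧ t + c' ≤ c ∧ Q s' c'

theorem Wp.seq {B : ℕ} {p q : Program} {Q : State → ℕ → Prop} {s : State} {c : ℕ}
    (h : Wp B p (Wp B q Q) s c) : Wp B (p ;; q) Q s c := by
  obtain ⟨t, s₁, c₁, hp, hc, t', s₂, c₂, hq, hc', hQ⟩ := h
  exact ⟨t + t', s₂, c₂, .seq hp hq, by omega, hQ⟩

theorem Wp.mono {B : ℕ} {p : Program} {Q Q' : State → ℕ → Prop} {s : State} {c c' : ℕ}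
    (h : Wp B p Q s c) (hc : c ≤ c') (hQ : ∀ s c, Q s c → Q' s c) : Wp B p Q' s c' := by
  obtain ⟨t, s', d, hp, hd, hq⟩ := h
  exact ⟨t, s', d, hp, by omega, hQ _ _ hq⟩

theorem Wp.ifLt {B : ℕ} {x y : ℕ} {p q : Program} {Q : State → ℕ → Prop} {s : State} {c : ℕ}
    (h₁ : s.reg x < s.reg y → Wp B p Q s c) (h₂ : ¬ s.reg x < s.reg y → Wp B q Q s c) :
    Wp B (.ifLt x y p q) Q s (c + 1) := by
  by_cases h : s.reg x < s.reg y
  · obtain ⟨t, s', d, hp, hd, hq⟩ := h₁ h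
    exact ⟨1 + t, s', d, .ifLt_true h hp, by omega, hq⟩
  · obtain ⟨t, s', d, hp, hd, hq⟩ := h₂ h
    exact ⟨1 + t, s', d, .ifLt_false h hp, by omega, hq⟩

/-- The rule for loops: the invariant `I` is about the state and the credits that are left, so
that it can hold the amortized analysis. Termination follows from the loss of one credit per
round. -/
theorem Wp.whileLt {B : ℕ} {x y : ℕ} {p : Program} {Q I : State → ℕ → Prop}
    (hbody : ∀ s c, I s c → s.reg x < s.reg y → ∃ d, d + 1 ≤ c ∧ Wp B p I s d)
    (hexit : ∀ s c, I s c → ¬ s.reg x < s.reg y → ∃ d, d + 1 ≤ c ∧ Q s d)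
    {s : State} {c : ℕ} (h : I s c) : Wp B (.whileLt x y p) Q s c := by
  induction c using Nat.strong_induction_on generalizing s with
  | _ c ih =>
    by_cases hxy : s.reg x < s.reg y
    · obtain ⟨d, hd, t, s₁, c₁, hp, hc₁, hI⟩ := hbody s c h hxy
      obtain ⟨t', s₂, c₂, hw, hc₂, hQ⟩ := ih c₁ (by omega) hI
      exact ⟨1 + t + t', s₂, c₂, .whileLt_true hxy hp hw, by omega, hQ⟩
    · obtain ⟨d, hd, hQ⟩ := hexit s c h hxy
      exact ⟨1, s, d, .whileLt_false hxy, by omega, hQ⟩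

/-- An upper bound on the number of steps of a program without loops. -/
def Program.cost : Program → ℕ
  | .seq p q => p.cost + q.cost
  | .ifLt _ _ p q => 1 + max p.cost q.cost
  | _ => 1

/-- Symbolic execution: a condition on the initial state under which a program without loops
does not overflow and halts in a state that satisfies `Q`. -/
def Program.Post (B : ℕ) : Program → (State → Prop) → State → Prop
  | .skip, Q, s => Q s
  | .const d a, Q, s => a < B ∧ Q (s.setReg d a)
  | .copy d x, Q, s => Q (s.setReg d (s.reg x))
  | .add d x y, Q, s => s.reg x + s.reg y < B ∧ Q (s.setReg d (s.reg x + s.reg y))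
  | .sub d x y, Q, s => Q (s.setReg d (s.reg x - s.reg y))
  | .mul d x y, Q, s => s.reg x * s.reg y < B ∧ Q (s.setReg d (s.reg x * s.reg y))
  | .load d b x, Q, s => Q (s.setReg d (s.mem b (s.reg x)))
  | .store b x y, Q, s => Q (s.setMem b (s.reg x) (s.reg y))
  | .seq p q, Q, s => p.Post B (q.Post B Q) s
  | .ifLt x y p q, Q, s =>
      (s.reg x < s.reg y → p.Post B Q s) ∧ (¬ s.reg x < s.reg y → q.Post B Q s)
  | .whileLt _ _ _, _, _ => False

theorem Program.Post.exec {B : ℕ} {p : Program} {Q : State → Prop} {s : State}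
    (h : p.Post B Q s) : ∃ t s', Exec B p s t s' ∧ t ≤ p.cost ∧ Q s' := by
  induction p generalizing Q s with
  | skip => exact ⟨_, _, .skip s, le_rfl, h⟩
  | const d a => exact ⟨_, _, .const s d a h.1, le_rfl, h.2⟩
  | copy d x => exact ⟨_, _, .copy s d x, le_rfl, h⟩
  | add d x y => exact ⟨_, _, .add s d x y h.1, le_rfl, h.2⟩
  | sub d x y => exact ⟨_, _, .sub s d x y, le_rfl, h⟩
  | mul d x y => exact ⟨_, _, .mul s d x y h.1, le_rfl, h.2⟩
  | load d b x => exact ⟨_, _, .load s d b x, le_rfl, h⟩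
  | store b x y => exact ⟨_, _, .store s b x y, le_rfl, h⟩
  | seq p q ihp ihq =>
    obtain ⟨t, s₁, hp, ht, h₁⟩ := ihp h
    obtain ⟨t', s₂, hq, ht', h₂⟩ := ihq h₁
    exact ⟨_, _, .seq hp hq, Nat.add_le_add ht ht', h₂⟩
  | ifLt x y p q ihp ihq =>
    by_cases hxy : s.reg x < s.reg y
    · obtain ⟨t, s₁, hp, ht, h₁⟩ := ihp (h.1 hxy)
      exact ⟨_, _, .ifLt_true hxy hp, by simp only [cost]; omega, h₁⟩
    · obtain ⟨t, s₁, hp, ht, h₁⟩ := ihq (h.2 hxy)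
      exact ⟨_, _, .ifLt_false hxy hp, by simp only [cost]; omega, h₁⟩
  | whileLt x y p => exact h.elim

theorem Wp.of_post {B : ℕ} {p : Program} {Q : State → ℕ → Prop} {s : State} {c : ℕ}
    (h : p.Post B (fun s' => Q s' c) s) : Wp B p Q s (c + p.cost) := by
  obtain ⟨t, s', hp, ht, hQ⟩ := h.exec
  exact ⟨t, s', c, hp, by omega, hQ⟩

end WordRAM

open Finset Function

/-! ### Matchings, prices and vertex covers -/

/-- The bipartite graph `adj` has a vertex cover of at most `K` vertices: `A` on the left side
and `C` on the right side. -/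
def HasCover (adj : ℕ → ℕ → Prop) (K : ℕ) : Prop :=
  ∃ A C : Finset ℕ, (∀ x y, adj x y → x ∈ A ∨ y ∈ C) ∧ #A + #C ≤ K

theorem HasCover.mono {adj : ℕ → ℕ → Prop} {K K' : ℕ} (h : HasCover adj K) (hK : K ≤ K') :
    HasCover adj K' := by
  obtain ⟨A, C, h, hc⟩ := h
  exact ⟨A, C, h, hc.trans hK⟩

/-- `mt` encodes a matching with `M` edges of the bipartite graph `adj`, whose right vertices are
among `1, …, m`: the right vertex `y` is matched to `mt y`, or unmatched if `mt y = 0`. The left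
vertex `cur` is unmatched (there is no such vertex if `cur = 0`), and `fl` flags `cur` and the
matched left vertices. -/
structure IsMatching (adj : ℕ → ℕ → Prop) (m : ℕ) (mt fl : ℕ → ℕ) (cur M : ℕ) : Prop where
  adj_mate : ∀ y, mt y ≠ 0 → adj (mt y) y
  inj : ∀ y y', mt y ≠ 0 → mt y = mt y' → y = y'
  cur_free : cur ≠ 0 → ∀ y, mt y ≠ cur
  flag : ∀ x, x ≠ 0 → (fl x ≠ 0 ↔ x = cur ∨ ∃ y, mt y = x)
  size : M = #{y ∈ Icc 1 m | mt y ≠ 0}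

/-- Every neighbor of the left vertex `x` has price at least `L`. -/
def Stuck (adj : ℕ → ℕ → Prop) (L : ℕ) (p : ℕ → ℕ) (x : ℕ) : Prop :=
  ∀ y, adj x y → L ≤ p y

/-- Undoing the `sp` exchanges recorded in `stk`, the last one first, leads from the matching
`mt` with the unmatched vertex `cur` through matchings only. -/
def Undoable (adj : ℕ → ℕ → Prop) (stk : ℕ → ℕ) : ℕ → (ℕ → ℕ) → ℕ → Prop
  | 0, _, _ => True
  | d + 1, mt, cur => adj cur (stk (d + 1)) ∧ mt (stk (d + 1)) ≠ 0 ∧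
      Undoable adj stk d (update mt (stk (d + 1)) cur) (mt (stk (d + 1)))

theorem Undoable.congr {adj : ℕ → ℕ → Prop} {stk stk' : ℕ → ℕ} {d : ℕ} {mt : ℕ → ℕ} {cur : ℕ}
    (h : Undoable adj stk d mt cur) (hs : ∀ e, 1 ≤ e → e ≤ d → stk' e = stk e) :
    Undoable adj stk' d mt cur := by
  induction d generalizing mt cur with
  | zero => trivial
  | succ d ih =>
    obtain ⟨h₁, h₂, h₃⟩ := h
    have he := hs (d + 1) (by omega) le_rfl
    refine ⟨by rwa [he], by rwa [he], ?_⟩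
    rw [he]
    exact ih h₃ fun e h1 h2 => hs e h1 (by omega)

/-- The invariant of a pass with price limit `L` that started with a matching of `M₀` edges. The
left vertices `1, …, i` have been handled, except `cur` if it is not `0`, and `aug` tells whether
the matching has grown. -/
structure PassInv (adj : ℕ → ℕ → Prop) (m L M₀ i : ℕ) (mt p fl stk : ℕ → ℕ)
    (cur sp aug M : ℕ) : Prop extends IsMatching adj m mt fl cur M where
  matched_of_pos : ∀ y, p y ≠ 0 → mt y ≠ 0
  price_le : ∀ y, p y ≤ L
  /-- Almost complementary slackness: a matched vertex has an almost cheapest mate. -/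
  slack : ∀ y y', mt y ≠ 0 → adj (mt y) y' → p y ≤ p y' + 1
  closed : aug = 0 → ∀ y, L ≤ p y →
    (∃ d, 1 ≤ d ∧ d ≤ sp ∧ stk d = y) ∨ Stuck adj L p (mt y)
  undoable : Undoable adj stk sp mt cur
  handled : ∀ x, 1 ≤ x → x ≤ i → fl x = 0 → Stuck adj L p x
  grown : aug ≠ 0 → M₀ < M
  le_size : M₀ ≤ M
  stack_empty : cur = 0 → sp = 0

section

variable {adj : ℕ → ℕ → Prop} {m L M₀ i : ℕ} {mt p fl stk : ℕ → ℕ} {cur sp aug M : ℕ}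

/-- Weak duality: each edge of the matching has its own vertex in the cover. -/
theorem IsMatching.le_of_hasCover (h : IsMatching adj m mt fl cur M) {K : ℕ}
    (hK : HasCover adj K) : M ≤ K := by
  obtain ⟨A, C, hAC, hc⟩ := hK
  rw [h.size]
  have h1 : {y ∈ Icc 1 m | mt y ≠ 0} ⊆
      {y ∈ Icc 1 m | mt y ≠ 0 ∧ mt y ∈ A} ∪ C := by
    intro y hy
    simp only [mem_filter, mem_union] at hy ⊢
    rcases hAC _ _ (h.adj_mate y hy.2) with h | h
    · exact .inl ⟨hy.1, hy.2, h⟩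
    · exact .inr h
  have h2 : #{y ∈ Icc 1 m | mt y ≠ 0 ∧ mt y ∈ A} ≤ #A := by
    apply Finset.card_le_card_of_injOn mt
    · intro y hy; simp at hy; exact hy.2.2
    · intro y hy y' hy' e; simp at hy; exact h.inj _ _ hy.2.1 e
  have := (card_le_card h1).trans (card_union_le _ _)
  omega

theorem IsMatching.empty : IsMatching adj m (fun _ => 0) (fun _ => 0) 0 0 where
  adj_mate := by simp
  inj := by simp
  cur_free := by simp
  flag := by intro x hx; simp [hx, eq_comm]
  size := by simp

/-- The mate of `y` is replaced by `cur` and becomes the unmatched vertex `cur`. -/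
theorem IsMatching.exchange (h : IsMatching adj m mt fl cur M) (hc : cur ≠ 0) {y : ℕ}
    (ha : adj cur y) (hy : mt y ≠ 0) : IsMatching adj m (update mt y cur) fl (mt y) M where
  adj_mate := by
    intro z hz
    obtain rfl | hzy := eq_or_ne z y
    · simpa
    · rw [update_of_ne hzy] at hz ⊢
      exact h.adj_mate z hz
  inj := by
    have := h.cur_free hc
    intro z z' hz e
    by_cases h1 : z = y <;> by_cases h2 : z' = y
    · rw [h1, h2]
    · subst h1; rw [update_self, update_of_ne h2] at e; exact absurd e.symm (this z')
    · subst h2; rw [update_self, update_of_ne h1] at e; exact absurd e (this z)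
    · rw [update_of_ne h1] at e hz; rw [update_of_ne h2] at e; exact h.inj _ _ hz e
  cur_free := by
    intro _ z e
    obtain rfl | hzy := eq_or_ne z y
    · rw [update_self] at e; exact h.cur_free hc z e.symm
    · rw [update_of_ne hzy] at e
      exact hzy (h.inj _ _ hy e.symm).symm
  flag := by
    intro x hx
    rw [h.flag x hx]
    constructor
    · rintro (rfl | ⟨z, rfl⟩)
      · exact .inr ⟨y, by simp⟩
      · obtain rfl | hzy := eq_or_ne z y
        · exact .inl rfl
        · exact .inr ⟨z, update_of_ne hzy _ _⟩
    · rintro (rfl | ⟨z, rfl⟩)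
      · exact .inr ⟨y, rfl⟩
      · obtain rfl | hzy := eq_or_ne z y
        · left; simp
        · right; exact ⟨z, (update_of_ne hzy _ _).symm⟩
  size := by
    rw [h.size]
    congr 1
    apply filter_congr
    intro z _
    obtain rfl | hzy := eq_or_ne z y
    · simp [hy, hc]
    · simp [hzy]

theorem IsMatching.augment (hadj : ∀ x y, adj x y → 1 ≤ x ∧ x ≤ m ∧ 1 ≤ y ∧ y ≤ m)
    (h : IsMatching adj m mt fl cur M) (hc : cur ≠ 0) {y : ℕ} (ha : adj cur y) (hy : mt y = 0) :
    IsMatching adj m (update mt y cur) fl 0 (M + 1) where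
  adj_mate := by
    intro z hz
    obtain rfl | hzy := eq_or_ne z y
    · simpa
    · rw [update_of_ne hzy] at hz ⊢
      exact h.adj_mate z hz
  inj := by
    have := h.cur_free hc
    intro z z' hz e
    by_cases h1 : z = y <;> by_cases h2 : z' = y
    · rw [h1, h2]
    · subst h1; rw [update_self, update_of_ne h2] at e; exact absurd e.symm (this z')
    · subst h2; rw [update_self, update_of_ne h1] at e; exact absurd e (this z)
    · rw [update_of_ne h1] at e hz; rw [update_of_ne h2] at e; exact h.inj _ _ hz e
  cur_free := by simp
  flag := by
    intro x hx
    rw [h.flag x hx]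
    constructor
    · rintro (rfl | ⟨z, rfl⟩)
      · exact .inr ⟨y, by simp⟩
      · exact .inr ⟨z, update_of_ne (by rintro rfl; exact hx hy) _ _⟩
    · rintro (rfl | ⟨z, rfl⟩)
      · exact absurd rfl hx
      · obtain rfl | hzy := eq_or_ne z y
        · left; simp
        · right; exact ⟨z, (update_of_ne hzy _ _).symm⟩
  size := by
    have hym := (hadj _ _ ha).2.2
    have : {z ∈ Icc 1 m | update mt y cur z ≠ 0} = insert y {z ∈ Icc 1 m | mt z ≠ 0} := by
      ext z
      obtain rfl | hzy := eq_or_ne z y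
      · simp [hc, hym]
      · simp [hzy]
    rw [this, card_insert_of_notMem (by simp [hy]), h.size]

/-- A pass starts with all prices equal to `0`. -/
theorem IsMatching.passInv (h : IsMatching adj m mt fl 0 M) (hL : 1 ≤ L) :
    PassInv adj m L M 0 mt (fun _ => 0) fl stk 0 0 0 M where
  toIsMatching := h
  matched_of_pos := by simp
  price_le := by simp
  slack := by simp
  closed := by intro _ y hy; omega
  undoable := trivial
  handled := by intros; omega
  grown := by simp
  le_size := le_rfl
  stack_empty := by simp

theorem Stuck.mono {p' : ℕ → ℕ} {x : ℕ} (h : Stuck adj L p x) (hp : ∀ y, p y ≤ p' y) :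
    Stuck adj L p' x := fun y hy => (h y hy).trans (hp y)

theorem le_update_succ (p : ℕ → ℕ) (y z : ℕ) : p z ≤ update p y (p y + 1) z := by
  obtain rfl | hz := eq_or_ne z y <;> simp [*]

namespace PassInv

/-- No search starts from the vertex `i + 1`. -/
theorem skip (h : PassInv adj m L M₀ i mt p fl stk 0 sp aug M)
    (hi : fl (i + 1) ≠ 0 ∨ Stuck adj L p (i + 1)) :
    PassInv adj m L M₀ (i + 1) mt p fl stk 0 sp aug M where
  __ := h
  handled := by
    intro x h1 h2 h3
    obtain rfl | hx := eq_or_ne x (i + 1)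
    · exact hi.resolve_left (by simp [h3])
    · exact h.handled x h1 (by omega) h3

/-- A search starts from the unmatched vertex `i + 1`. -/
theorem start (h : PassInv adj m L M₀ i mt p fl stk 0 sp aug M) (hi : fl (i + 1) = 0) :
    PassInv adj m L M₀ (i + 1) mt p (update fl (i + 1) 1) stk (i + 1) sp aug M where
  adj_mate := h.adj_mate
  inj := h.inj
  cur_free := by
    intro _ y hy
    exact (h.flag (i + 1) (by omega)).2 (.inr ⟨y, hy⟩) hi
  flag := by
    intro x hx
    obtain rfl | hxi := eq_or_ne x (i + 1)
    · simp
    · rw [update_of_ne hxi, h.flag x hx]; simp [hx, hxi]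
  size := h.size
  matched_of_pos := h.matched_of_pos
  price_le := h.price_le
  slack := h.slack
  closed := h.closed
  undoable := by rw [h.stack_empty rfl]; trivial
  handled := by
    intro x h1 h2 h3
    obtain rfl | hx := eq_or_ne x (i + 1)
    · simp at h3
    · rw [update_of_ne hx] at h3
      exact h.handled x h1 (by omega) h3
  grown := h.grown
  le_size := h.le_size
  stack_empty := by omega

/-- The search ends without an augmentation: `cur` is stuck and no exchange is left to undo. -/
theorem giveUp (h : PassInv adj m L M₀ i mt p fl stk cur 0 aug M) (hc : cur ≠ 0)
    (hs : Stuck adj L p cur) :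
    PassInv adj m L M₀ i mt p (update fl cur 0) stk 0 0 aug M where
  __ := h
  cur_free := by simp
  flag := by
    intro x hx
    obtain rfl | hxi := eq_or_ne x cur
    · simpa [hx] using h.cur_free hc
    · rw [update_of_ne hxi, h.flag x hx]; simp [hx, hxi]
  undoable := trivial
  handled := by
    intro x h1 h2 h3
    obtain rfl | hxi := eq_or_ne x cur
    · exact hs
    · rw [update_of_ne hxi] at h3
      exact h.handled x h1 h2 h3
  stack_empty := by simp

/-- The slack condition survives when `cur` takes a cheapest neighbor `y`. -/
theorem slack_bid (h : PassInv adj m L M₀ i mt p fl stk cur sp aug M) {y : ℕ}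
    (hmin : ∀ z, adj cur z → p y ≤ p z) (z z' : ℕ) (hz : update mt y cur z ≠ 0)
    (ha : adj (update mt y cur z) z') :
    update p y (p y + 1) z ≤ update p y (p y + 1) z' + 1 := by
  have hle := le_update_succ p y z'
  obtain rfl | hzy := eq_or_ne z y
  · simp only [update_self] at ha ⊢
    have := hmin _ ha
    omega
  · rw [update_of_ne hzy] at ha hz ⊢
    have := h.slack z z' hz ha
    omega

/-- The vertex `cur` takes its cheapest neighbor `y` away from the mate of `y`, which becomes
`cur`. -/
theorem exchange (h : PassInv adj m L M₀ i mt p fl stk cur sp aug M) (hc : cur ≠ 0) {y : ℕ}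
    (ha : adj cur y) (hL : p y < L) (hmin : ∀ z, adj cur z → p y ≤ p z) (hy : mt y ≠ 0) :
    PassInv adj m L M₀ i (update mt y cur) (update p y (p y + 1)) fl (update stk (sp + 1) y)
      (mt y) (sp + 1) aug M where
  __ := h.toIsMatching.exchange hc ha hy
  matched_of_pos := by
    intro z hz
    obtain rfl | hzy := eq_or_ne z y
    · simpa
    · rw [update_of_ne hzy] at hz ⊢
      exact h.matched_of_pos z hz
  price_le := by
    intro z
    obtain rfl | hzy := eq_or_ne z y
    · simpa using hL
    · rw [update_of_ne hzy]; exact h.price_le z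
  slack := h.slack_bid hmin
  closed := by
    intro h0 z hz
    obtain rfl | hzy := eq_or_ne z y
    · exact .inl ⟨sp + 1, by omega, le_rfl, by simp⟩
    · rw [update_of_ne hzy] at hz ⊢
      rcases h.closed h0 z hz with ⟨d, h1, h2, h3⟩ | hs
      · exact .inl ⟨d, h1, by omega, by rw [update_of_ne (by omega)]; exact h3⟩
      · exact .inr (hs.mono (le_update_succ p y))
  undoable := by
    refine ⟨?_, ?_, ?_⟩
    · simpa using h.adj_mate y hy
    · simpa
    · simp only [update_self, update_idem, update_eq_self]
      exact h.undoable.congr fun e _ he => update_of_ne (by omega) _ _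
  handled := fun x h1 h2 h3 => (h.handled x h1 h2 h3).mono (le_update_succ p y)
  grown := h.grown
  le_size := h.le_size
  stack_empty := fun e => absurd e hy

/-- The vertex `cur` is matched to its cheapest neighbor `y`, which was unmatched. -/
theorem augment (hadj : ∀ x y, adj x y → 1 ≤ x ∧ x ≤ m ∧ 1 ≤ y ∧ y ≤ m)
    (h : PassInv adj m L M₀ i mt p fl stk cur sp aug M) (hc : cur ≠ 0) {y : ℕ}
    (ha : adj cur y) (hL : p y < L) (hmin : ∀ z, adj cur z → p y ≤ p z) (hy : mt y = 0) :
    PassInv adj m L M₀ i (update mt y cur) (update p y (p y + 1)) fl stk 0 0 1 (M + 1) where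
  __ := h.toIsMatching.augment hadj hc ha hy
  matched_of_pos := by
    intro z hz
    obtain rfl | hzy := eq_or_ne z y
    · simpa
    · rw [update_of_ne hzy] at hz ⊢
      exact h.matched_of_pos z hz
  price_le := by
    intro z
    obtain rfl | hzy := eq_or_ne z y
    · simpa using hL
    · rw [update_of_ne hzy]; exact h.price_le z
  slack := h.slack_bid hmin
  closed := by simp
  undoable := trivial
  handled := fun x h1 h2 h3 => (h.handled x h1 h2 h3).mono (le_update_succ p y)
  grown := fun _ => by have := h.le_size; omega
  le_size := by have := h.le_size; omega
  stack_empty := by simp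

/-- The last exchange is undone, as `cur` is stuck. -/
theorem backtrack (h : PassInv adj m L M₀ i mt p fl stk cur (sp + 1) aug M) (hc : cur ≠ 0)
    (hs : Stuck adj L p cur) :
    PassInv adj m L M₀ i (update mt (stk (sp + 1)) cur) p fl stk (mt (stk (sp + 1))) sp aug M := by
  obtain ⟨ha, hy, hu⟩ := h.undoable
  generalize hyy : stk (sp + 1) = y at ha hy hu ⊢
  exact {
    __ := h.toIsMatching.exchange hc ha hy
    matched_of_pos := by
      intro z hz
      obtain rfl | hzy := eq_or_ne z y
      · simpa
      · rw [update_of_ne hzy]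
        exact h.matched_of_pos z hz
    price_le := h.price_le
    slack := by
      intro z z' hz hz'
      obtain rfl | hzy := eq_or_ne z y
      · rw [update_self] at hz'
        -- all neighbors of `cur` have the maximal price, so that any mate is a cheapest one
        have := hs z' hz'
        have := h.price_le z
        omega
      · rw [update_of_ne hzy] at hz hz'
        exact h.slack z z' hz hz'
    closed := by
      intro h0 z hz
      obtain rfl | hzy := eq_or_ne z y
      · right; rwa [update_self]
      · rw [update_of_ne hzy]
        rcases h.closed h0 z hz with ⟨d, h1, h2, h3⟩ | hs
        · refine .inl ⟨d, h1, ?_, h3⟩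
          by_contra h4
          obtain rfl : d = sp + 1 := by omega
          exact hzy (h3.symm.trans hyy)
        · exact .inr hs
    undoable := hu
    handled := h.handled
    grown := h.grown
    le_size := h.le_size
    stack_empty := fun e => absurd e hy }

open scoped Classical in
/-- The vertices of price at least `j` and their counterpart on the left side cover all edges.
Such a cover has an endpoint of every edge of the matching, and two endpoints only where the
price is exactly `j`, and, if `j = L`, only where the matching has grown. -/
theorem hasCover_level (hadj : ∀ x y, adj x y → 1 ≤ x ∧ x ≤ m ∧ 1 ≤ y ∧ y ≤ m)
    (h : PassInv adj m L M₀ m mt p fl stk 0 sp aug M) {j : ℕ} (h1 : 1 ≤ j) (hj : j ≤ L) :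
    HasCover adj (M + #{y ∈ Icc 1 m | p y = j ∧ ¬ Stuck adj j p (mt y)}) := by
  refine ⟨{x ∈ Icc 1 m | ¬ Stuck adj j p x}, {y ∈ Icc 1 m | j ≤ p y}, ?_, ?_⟩
  · intro x y hxy
    obtain ⟨a1, a2, a3, a4⟩ := hadj x y hxy
    rcases le_or_gt j (p y) with hp | hp
    · exact .inr (by simp [a3, a4, hp])
    · refine .inl (mem_filter.2 ⟨mem_Icc.2 ⟨a1, a2⟩, fun hs => ?_⟩)
      have := hs y hxy
      omega
  · have hA : #{x ∈ Icc 1 m | ¬ Stuck adj j p x} ≤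
        #{y ∈ Icc 1 m | mt y ≠ 0 ∧ ¬ Stuck adj j p (mt y)} := by
      refine (card_le_card ?_).trans (card_image_le (f := mt))
      intro x hx
      simp only [mem_filter, mem_Icc] at hx
      -- an unmatched left vertex is stuck at `L ≥ j` at the end of the pass
      have hfl : fl x ≠ 0 := fun e =>
        hx.2 fun y hy => hj.trans (h.handled x hx.1.1 hx.1.2 e y hy)
      rcases (h.flag x (by omega)).1 hfl with e | ⟨y, rfl⟩
      · omega
      · have hy : mt y ≠ 0 := by omega
        have := hadj _ _ (h.adj_mate y hy)
        simp only [mem_image, mem_filter, mem_Icc]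
        exact ⟨y, ⟨this.2.2, hy, hx.2⟩, rfl⟩
    have hsplit := card_union_add_card_inter
      {y ∈ Icc 1 m | mt y ≠ 0 ∧ ¬ Stuck adj j p (mt y)} {y ∈ Icc 1 m | j ≤ p y}
    have hunion : #({y ∈ Icc 1 m | mt y ≠ 0 ∧ ¬ Stuck adj j p (mt y)} ∪
        {y ∈ Icc 1 m | j ≤ p y}) ≤ M := by
      rw [h.size]
      apply card_le_card
      intro y hy
      simp only [mem_union, mem_filter] at hy ⊢
      rcases hy with hy | hy
      · exact ⟨hy.1, hy.2.1⟩
      · exact ⟨hy.1, h.matched_of_pos y (by omega)⟩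
    have hinter : #({y ∈ Icc 1 m | mt y ≠ 0 ∧ ¬ Stuck adj j p (mt y)} ∩
        {y ∈ Icc 1 m | j ≤ p y}) ≤ #{y ∈ Icc 1 m | p y = j ∧ ¬ Stuck adj j p (mt y)} := by
      apply card_le_card
      intro y hy
      simp only [mem_inter, mem_filter] at hy ⊢
      obtain ⟨⟨hy, hm, hs⟩, -, hp⟩ := hy
      refine ⟨hy, ?_, hs⟩
      -- a matched pair with both endpoints in the cover: `j ≤ p y ≤ p z + 1 ≤ j`
      simp only [Stuck, not_forall] at hs
      obtain ⟨z, hz, hz'⟩ := hs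
      have := h.slack y z hm hz
      omega
    omega

/-- Without an augmentation all mates of the vertices of price `L` are stuck, so that the cover of
level `L` is no larger than the matching. -/
theorem hasCover_of_not_grown (hadj : ∀ x y, adj x y → 1 ≤ x ∧ x ≤ m ∧ 1 ≤ y ∧ y ≤ m)
    (h : PassInv adj m L M₀ m mt p fl stk 0 sp aug M) (hL : 1 ≤ L) (h0 : aug = 0) :
    HasCover adj M := by
  classical
  have hcov := h.hasCover_level hadj hL le_rfl
  rwa [filter_false_of_mem, card_empty, add_zero] at hcov
  rintro y - ⟨hp, hs⟩
  rcases h.closed h0 y hp.ge with ⟨d, h1, h2, -⟩ | h'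
  · have := h.stack_empty rfl
    omega
  · exact hs h'

/-- One of the `L` price levels has at most `m / L` vertices. -/
theorem exists_hasCover (hadj : ∀ x y, adj x y → 1 ≤ x ∧ x ≤ m ∧ 1 ≤ y ∧ y ≤ m)
    (h : PassInv adj m L M₀ m mt p fl stk 0 sp aug M) (hL : 1 ≤ L) (hm : m ≤ L * L) :
    HasCover adj (M + L) := by
  classical
  obtain ⟨j, hj, hc⟩ : ∃ j ∈ Icc 1 L, #{y ∈ Icc 1 m | p y = j} ≤ L := by
    by_contra! hcon
    have h1 : ∑ j ∈ Icc 1 L, (L + 1) ≤ ∑ j ∈ Icc 1 L, #{y ∈ Icc 1 m | p y = j} :=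
      sum_le_sum fun j hj => hcon j hj
    have h2 : ∑ j ∈ Icc 1 L, #{y ∈ Icc 1 m | p y = j} ≤ m := by
      rw [← card_biUnion]
      · refine (card_le_card (t := Icc 1 m) ?_).trans (by simp)
        intro y hy
        simp only [mem_biUnion, mem_filter] at hy
        obtain ⟨_, _, hy, _⟩ := hy
        exact hy
      · intro a _ b _ hab
        rw [Function.onFun, disjoint_left]
        intro y hy hy'
        simp only [mem_filter] at hy hy'
        exact hab (hy.2.symm.trans hy'.2)
    simp only [sum_const, Nat.card_Icc, smul_eq_mul] at h1
    simp only [Nat.add_sub_cancel] at h1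
    nlinarith
  rw [mem_Icc] at hj
  refine (h.hasCover_level hadj hj.1 hj.2).mono (Nat.add_le_add_left (le_trans ?_ hc) M)
  exact card_le_card fun y hy => by
    simp only [mem_filter] at hy ⊢
    exact ⟨hy.1, hy.2.1⟩

theorem sum_price_le (h : PassInv adj m L M₀ i mt p fl stk cur sp aug M) :
    ∑ y ∈ Icc 1 m, p y ≤ m * L := by
  refine (sum_le_sum fun y _ => h.price_le y).trans ?_
  simp

end PassInv

theorem sum_update_succ {y m : ℕ} (p : ℕ → ℕ) (h1 : 1 ≤ y) (h2 : y ≤ m) :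
    ∑ z ∈ Icc 1 m, update p y (p y + 1) z = ∑ z ∈ Icc 1 m, p z + 1 := by
  have hy : y ∈ Icc 1 m := by simp [h1, h2]
  have := sum_eq_add_sum_sdiff_singleton_of_mem hy p
  rw [sum_update_of_mem hy]
  omega
end

/-! ### Solutions of Bicolored P₃ Deletion as vertex covers -/

section

variable {n : ℕ}

/-- The edge with the label `x` of the list `es` joins `u` and `v` and has the color `c`. The
labels are `1, …, es.length`, so that `0` can stand for no edge. -/
def HasLabel (es : List (Fin n × Fin n × Bool)) (x : ℕ) (u v : Fin n) (c : Bool) : Prop :=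
  1 ≤ x ∧ (es[x - 1]? = some (u, v, c) ∨ es[x - 1]? = some (v, u, c))

/-- The conflict graph: the edges with the labels `x` and `y` are the red and the blue edge of a
bicolored `P₃`. -/
def Conflict (G : TwoColoredGraph (Fin n)) (es : List (Fin n × Fin n × Bool)) (x y : ℕ) : Prop :=
  ∃ u v w, G.IsBicoloredP3 u v w ∧ HasLabel es x u v true ∧ HasLabel es y v w false

variable {G : TwoColoredGraph (Fin n)} {es : List (Fin n × Fin n × Bool)} {x y k : ℕ}
  {u v w u' v' : Fin n} {c c' : Bool}

theorem HasLabel.symm (h : HasLabel es x u v c) : HasLabel es x v u c := ⟨h.1, h.2.symm⟩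

theorem HasLabel.le_length (h : HasLabel es x u v c) : x ≤ es.length := by
  have h1 := h.1
  have : x - 1 < es.length := by
    rcases h.2 with h | h <;> exact (List.getElem?_eq_some_iff.1 h).1
  omega

theorem HasLabel.map_eq (h : HasLabel es x u v c) :
    (es.map fun e => s(e.1, e.2.1))[x - 1]? = some s(u, v) := by
  rcases h.2 with h | h <;> simp [h, Sym2.eq_swap]

theorem HasLabel.eq (hes : G.IsEdgeList es) (h : HasLabel es x u v c) (h' : HasLabel es y u v c') :
    x = y ∧ c = c' := by
  have hxy : x - 1 = y - 1 :=
    (List.getElem?_inj (by have := h.1; have := h.le_length; simp; omega) hes.1).1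
      (h.map_eq.trans h'.map_eq.symm)
  have h1 := h.1
  have h2 := h'.1
  obtain rfl : x = y := by omega
  refine ⟨rfl, ?_⟩
  rcases h.2 with h | h <;> rcases h'.2 with h' | h' <;> rw [h] at h' <;> simp_all

theorem HasLabel.edge_eq (h : HasLabel es x u v c) (h' : HasLabel es x u' v' c') :
    s(u, v) = s(u', v') ∧ c = c' := by
  refine ⟨Option.some.inj (h.map_eq.symm.trans h'.map_eq), ?_⟩
  rcases h.2 with h | h <;> rcases h'.2 with h' | h' <;> rw [h] at h' <;> simp_all

theorem exists_hasLabel_iff : (∃ x, HasLabel es x u v c) ↔ (u, v, c) ∈ es ∨ (v, u, c) ∈ es := by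
  simp only [List.mem_iff_getElem?]
  constructor
  · rintro ⟨x, -, h | h⟩
    exacts [.inl ⟨_, h⟩, .inr ⟨_, h⟩]
  · rintro (⟨i, h⟩ | ⟨i, h⟩)
    exacts [⟨i + 1, by omega, .inl h⟩, ⟨i + 1, by omega, .inr h⟩]

theorem red_adj_iff (hes : G.IsEdgeList es) : G.red.Adj u v ↔ ∃ x, HasLabel es x u v true := by
  rw [exists_hasLabel_iff, hes.2.1]

theorem blue_adj_iff (hes : G.IsEdgeList es) : G.blue.Adj u v ↔ ∃ x, HasLabel es x u v false := by
  rw [exists_hasLabel_iff, hes.2.2]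

theorem graph_adj_iff (hes : G.IsEdgeList es) : G.graph.Adj u v ↔ ∃ x c, HasLabel es x u v c := by
  simp [TwoColoredGraph.graph, red_adj_iff hes, blue_adj_iff hes, exists_or, or_comm]

theorem numEdges_eq_length (hes : G.IsEdgeList es) : G.numEdges = es.length := by
  have : G.graph.edgeSet = ((es.map fun e => s(e.1, e.2.1)).toFinset : Set (Sym2 (Fin n))) := by
    ext e
    induction e with
    | _ u v =>
      simp only [SimpleGraph.mem_edgeSet, graph_adj_iff hes, exists_comm (α := ℕ),
        exists_hasLabel_iff, List.coe_toFinset, Set.mem_ofPred_eq, List.mem_map, Prod.exists,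
        Sym2.eq_iff]
      constructor
      · rintro ⟨c, h | h⟩
        exacts [⟨u, v, c, h, by simp⟩, ⟨v, u, c, h, by simp⟩]
      · rintro ⟨a, b, c, h, ⟨rfl, rfl⟩ | ⟨rfl, rfl⟩⟩
        exacts [⟨c, .inl h⟩, ⟨c, .inr h⟩]
  rw [TwoColoredGraph.numEdges, this, Set.ncard_coe_finset, List.toFinset_card_of_nodup hes.1,
    List.length_map]

theorem Conflict.bounds (h : Conflict G es x y) :
    1 ≤ x ∧ x ≤ es.length ∧ 1 ≤ y ∧ y ≤ es.length := by
  obtain ⟨u, v, w, -, hx, hy⟩ := h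
  exact ⟨hx.1, hx.le_length, hy.1, hy.le_length⟩

/-- A solution contains an edge of every bicolored `P₃` of `G`, as deletions keep its end vertices
nonadjacent. -/
theorem HasCover.of_isYesInstance (hes : G.IsEdgeList es) (h : G.IsYesInstanceBPD k) :
    HasCover (Conflict G es) k := by
  classical
  obtain ⟨S, hS, hk, hfree⟩ := h
  let f : ℕ → Option (Sym2 (Fin n)) := fun x => (es.map fun e => s(e.1, e.2.1))[x - 1]?
  let A : Finset ℕ := {x ∈ Icc 1 es.length | ∃ u v, HasLabel es x u v true ∧ s(u, v) ∈ S}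
  let C : Finset ℕ := {x ∈ Icc 1 es.length | ∃ u v, HasLabel es x u v false ∧ s(u, v) ∈ S}
  refine ⟨A, C, ?_, ?_⟩
  · rintro x y ⟨u, v, w, ⟨h1, h2, h3⟩, hx, hy⟩
    by_contra! hcon
    have hx' : s(u, v) ∉ S := fun h => hcon.1 (by
      simp only [A, mem_filter, mem_Icc]
      exact ⟨⟨hx.1, hx.le_length⟩, u, v, hx, h⟩)
    have hy' : s(v, w) ∉ S := fun h => hcon.2 (by
      simp only [C, mem_filter, mem_Icc]
      exact ⟨⟨hy.1, hy.le_length⟩, v, w, hy, h⟩)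
    refine hfree u v w ⟨?_, ?_, ?_⟩
    · simp [TwoColoredGraph.deleteEdges, h1, hx']
    · simp [TwoColoredGraph.deleteEdges, h2, hy']
    · simp only [TwoColoredGraph.graph, SimpleGraph.sup_adj] at h3
      push Not at h3
      simp [TwoColoredGraph.graph, TwoColoredGraph.deleteEdges, h3]
  · rw [← card_union_of_disjoint]
    · refine le_trans ?_ hk
      rw [← card_map (s := S) Embedding.some]
      apply card_le_card_of_injOn f
      · intro x hx
        simp only [coe_union, A, C, Set.mem_union, mem_coe, mem_filter] at hx
        rcases hx with ⟨-, u, v, hx, hS⟩ | ⟨-, u, v, hx, hS⟩ <;>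
          exact mem_map.2 ⟨_, hS, hx.map_eq.symm⟩
      · intro x hx x' hx' e
        simp only [coe_union, A, C, Set.mem_union, mem_coe, mem_filter, mem_Icc] at hx hx'
        have := (List.getElem?_inj (by simp; omega) hes.1).1 e
        omega
    · rw [disjoint_left]
      intro x hx hx'
      simp only [A, C, mem_filter] at hx hx'
      obtain ⟨-, u, v, hx, -⟩ := hx
      obtain ⟨-, u', v', hx', -⟩ := hx'
      exact absurd (hx.edge_eq hx').2 (by simp)

/-- Deleting conflicting edges that cover all conflicts creates no new bicolored `P₃`: a third
side `uw` of a triangle that was deleted is part of a bicolored `P₃`, so that the triangle is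
endangered. -/
theorem HasCover.isYesInstance (hes : G.IsEdgeList es) (hG : ∀ u v w, ¬ G.IsEndangeredK3 u v w)
    (h : HasCover (Conflict G es) k) : G.IsYesInstanceBPD k := by
  classical
  obtain ⟨A, C, hAC, hk⟩ := h
  let f : ℕ → Option (Sym2 (Fin n)) := fun x => (es.map fun e => s(e.1, e.2.1))[x - 1]?
  let T : Finset (Option (Sym2 (Fin n))) :=
    {x ∈ A | ∃ y, Conflict G es x y}.image f ∪ {y ∈ C | ∃ x, Conflict G es x y}.image f
  have hmem : ∀ e, e ∈ T.eraseNone ↔ (∃ x ∈ A, (∃ y, Conflict G es x y) ∧ f x = some e) ∨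
      (∃ y ∈ C, (∃ x, Conflict G es x y) ∧ f y = some e) := by
    intro e
    simp only [mem_eraseNone, T, mem_union, mem_image, mem_filter, and_assoc]
  have hpart : ∀ e, e ∈ T.eraseNone → G.PartOfBicoloredP3 e := by
    intro e he
    rcases (hmem e).1 he with ⟨x, -, ⟨y, u, v, w, hp, hx, hy⟩, hf⟩ |
      ⟨y, -, ⟨x, u, v, w, hp, hx, hy⟩, hf⟩
    · exact ⟨u, v, w, hp, .inl (Option.some.inj (hf.symm.trans hx.map_eq))⟩
    · exact ⟨u, v, w, hp, .inr (Option.some.inj (hf.symm.trans hy.map_eq))⟩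
  refine ⟨T.eraseNone, ?_, ?_, ?_⟩
  · intro e he
    obtain ⟨u, v, w, ⟨h1, h2, -⟩, rfl | rfl⟩ := hpart e he
    · exact Or.inl h1
    · exact Or.inr h2
  · refine le_trans ?_ hk
    refine (card_eraseNone_le _).trans ((card_union_le _ _).trans (Nat.add_le_add ?_ ?_)) <;>
      exact card_image_le.trans (card_filter_le _ _)
  · rintro u v w ⟨h1, h2, h3⟩
    simp only [TwoColoredGraph.deleteEdges, SimpleGraph.deleteEdges_adj, mem_coe] at h1 h2
    by_cases huw : G.graph.Adj u w
    · have hS : s(u, w) ∈ T.eraseNone := by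
        by_contra hS
        apply h3
        rcases huw with huw | huw
        exacts [.inl (SimpleGraph.deleteEdges_adj.2 ⟨huw, hS⟩),
          .inr (SimpleGraph.deleteEdges_adj.2 ⟨huw, hS⟩)]
      rcases huw with huw | huw
      · exact hG v u w ⟨.inl ⟨h1.1.symm, huw, h2.1⟩, .inr (hpart _ hS)⟩
      · exact hG u w v ⟨.inr ⟨huw, h2.1.symm, h1.1⟩, .inl (hpart _ hS)⟩
    · obtain ⟨x, hx⟩ := (red_adj_iff hes).1 h1.1
      obtain ⟨y, hy⟩ := (blue_adj_iff hes).1 h2.1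
      have hc : Conflict G es x y := ⟨u, v, w, ⟨h1.1, h2.1, huw⟩, hx, hy⟩
      rcases hAC x y hc with h | h
      · exact h1.2 ((hmem _).2 (.inl ⟨x, h, ⟨y, hc⟩, hx.map_eq⟩))
      · exact h2.2 ((hmem _).2 (.inr ⟨y, h, ⟨x, hc⟩, hy.map_eq⟩))

end

namespace WordRAM

/-! ### Searching for a cheapest neighbor -/

section

variable {n : ℕ} {G : TwoColoredGraph (Fin n)} {es : List (Fin n × Fin n × Bool)} {B k : ℕ}

/-- The registers and arrays that stay fixed once they have been set up: `n`, `m`, `k`, the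
constants `0` and `1`, the edge list, the adjacency matrix (array `3`), and the matrix of the
labels of the blue edges (array `4`). -/
structure Ready (G : TwoColoredGraph (Fin n)) (es : List (Fin n × Fin n × Bool)) (k : ℕ)
    (s : State) : Prop where
  reg_n : s.reg 0 = n
  reg_m : s.reg 1 = es.length
  reg_k : s.reg 2 = k
  reg_zero : s.reg 3 = 0
  reg_one : s.reg 4 = 1
  mem_edge : ∀ (i : ℕ) (u v : Fin n) (c : Bool), es[i]? = some (u, v, c) →
    s.mem 0 i = u ∧ s.mem 1 i = v ∧ s.mem 2 i = if c then 1 else 0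
  mem_adj : ∀ u v : Fin n, s.mem 3 (u * n + v) ≠ 0 ↔ G.graph.Adj u v
  mem_blue : ∀ (u v : Fin n) (y : ℕ),
    s.mem 4 (u * n + v) = y ∧ y ≠ 0 ↔ HasLabel es y u v false

theorem Ready.of_eq {s s' : State} (h : Ready G es k s)
    (hr : s'.reg 0 = s.reg 0 ∧ s'.reg 1 = s.reg 1 ∧ s'.reg 2 = s.reg 2 ∧ s'.reg 3 = s.reg 3 ∧
      s'.reg 4 = s.reg 4)
    (hm : s'.mem 0 = s.mem 0 ∧ s'.mem 1 = s.mem 1 ∧ s'.mem 2 = s.mem 2 ∧ s'.mem 3 = s.mem 3 ∧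
      s'.mem 4 = s.mem 4) : Ready G es k s' where
  reg_n := hr.1.trans h.reg_n
  reg_m := hr.2.1.trans h.reg_m
  reg_k := hr.2.2.1.trans h.reg_k
  reg_zero := hr.2.2.2.1.trans h.reg_zero
  reg_one := hr.2.2.2.2.trans h.reg_one
  mem_edge := by rw [hm.1, hm.2.1, hm.2.2.1]; exact h.mem_edge
  mem_adj := by rw [hm.2.2.2.1]; exact h.mem_adj
  mem_blue := by rw [hm.2.2.2.2]; exact h.mem_blue

/-- The conflicts of the red edge `uv`, as the scan of the rows of `u` and `v` finds them. -/
theorem Ready.conflict_iff (hes : G.IsEdgeList es) {s : State} (h : Ready G es k s) {x : ℕ}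
    {u v : Fin n} (hx : HasLabel es x u v true) (y : ℕ) :
    Conflict G es x y ↔ y ≠ 0 ∧ ∃ w : Fin n,
      (s.mem 3 (u * n + w) = 0 ∧ s.mem 4 (v * n + w) = y) ∨
      (s.mem 3 (v * n + w) = 0 ∧ s.mem 4 (u * n + w) = y) := by
  have hadj : ∀ u v : Fin n, s.mem 3 (u * n + v) = 0 ↔ ¬ G.graph.Adj u v := fun u v => by
    rw [← h.mem_adj, not_not]
  constructor
  · rintro ⟨a, b, w, ⟨-, -, h3⟩, hx', hy⟩
    obtain ⟨h4, h0⟩ := (h.mem_blue _ _ _).2 hy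
    refine ⟨h0, w, ?_⟩
    rcases Sym2.eq_iff.1 (hx.edge_eq hx').1 with ⟨rfl, rfl⟩ | ⟨rfl, rfl⟩
    · exact .inl ⟨(hadj _ _).2 h3, h4⟩
    · exact .inr ⟨(hadj _ _).2 h3, h4⟩
  · rintro ⟨h0, w, ⟨h3, h4⟩ | ⟨h3, h4⟩⟩
    · have hy := (h.mem_blue _ _ _).1 ⟨h4, h0⟩
      exact ⟨u, v, w, ⟨(red_adj_iff hes).2 ⟨x, hx⟩, (blue_adj_iff hes).2 ⟨y, hy⟩,
        (hadj _ _).1 h3⟩, hx, hy⟩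
    · have hy := (h.mem_blue _ _ _).1 ⟨h4, h0⟩
      exact ⟨v, u, w, ⟨(red_adj_iff hes).2 ⟨x, hx.symm⟩, (blue_adj_iff hes).2 ⟨y, hy⟩,
        (hadj _ _).1 h3⟩, hx.symm, hy⟩

/-- If the adjacency matrix is `0` at `x` and `y` is the position of a blue edge that is cheaper
than the price in register `12`, the label and the price of this edge are kept. -/
def check (x y : ℕ) : Program :=
  .load 19 3 x ;; .ifLt 3 19 .skip (.load 20 4 y ;; .ifLt 3 20
    (.load 21 5 20 ;; .ifLt 21 12 (.copy 12 21 ;; .copy 13 20) .skip) .skip)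

/-- The effect of `check`: register `12` does not grow and is at most the price of the candidate, and
registers `12` and `13` are unchanged or hold the candidate. -/
theorem check_post {x y : ℕ} (hy : y ≠ 19) {Q : State → Prop} {s : State} (h3 : s.reg 3 = 0)
    (hQ : ∀ s', s'.mem = s.mem → (∀ r < 19, r ≠ 12 → r ≠ 13 → s'.reg r = s.reg r) →
      (s'.reg 12 = s.reg 12 ∧ s'.reg 13 = s.reg 13 ∨
        s.mem 3 (s.reg x) = 0 ∧ s.mem 4 (s.reg y) ≠ 0 ∧ s'.reg 13 = s.mem 4 (s.reg y) ∧
        s'.reg 12 = s.mem 5 (s.mem 4 (s.reg y))) → s'.reg 12 ≤ s.reg 12 →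
      (s.mem 3 (s.reg x) = 0 → s.mem 4 (s.reg y) ≠ 0 →
        s'.reg 12 ≤ s.mem 5 (s.mem 4 (s.reg y))) → Q s') : (check x y).Post B Q s := by
  have hframe : ∀ r < 19, r ≠ 19 ∧ r ≠ 20 ∧ r ≠ 21 := fun r hr => by omega
  simp only [check, Program.Post, State.setReg_reg, State.setReg_mem]
  simp only [hy, h3, if_true, if_false, Nat.reduceEqDiff]
  refine ⟨fun _ => hQ _ rfl ?_ ?_ ?_ ?_, fun h => ⟨fun h' => ⟨fun h'' => hQ _ rfl ?_ ?_ ?_ ?_,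
    fun h'' => hQ _ rfl ?_ ?_ ?_ ?_⟩, fun h' => hQ _ rfl ?_ ?_ ?_ ?_⟩⟩
  all_goals try
    intro r (hr : r < 19)
    obtain ⟨h19, h20, h21⟩ := hframe r hr
    simp +contextual [h19, h20, h21]
  all_goals simp
  all_goals omega

/-- One round of `scan`: the two candidates for the third vertex in register `14`. -/
def scanStep : Program :=
  .add 17 15 14 ;; .add 18 16 14 ;; check 17 18 ;; check 18 17 ;; .add 14 14 4

/-- The first entries of the rows of the two endpoints of the edge in register `9`. -/
def scanInit : Program :=
  .sub 17 9 4 ;; .load 15 0 17 ;; .load 16 1 17 ;; .mul 15 15 0 ;; .mul 16 16 0 ;;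
  .copy 12 5 ;; .const 13 0 ;; .const 14 0

/-- Puts the least price among the neighbors of the left vertex in register `9`, or the price
limit if this is smaller, into register `12`, and the neighbor into register `13`. -/
def scan : Program := scanInit ;; .whileLt 14 0 scanStep

/-- The invariant of `scan`, started in state `s₀` at a red edge `uv`. -/
structure ScanInv (G : TwoColoredGraph (Fin n)) (es : List (Fin n × Fin n × Bool)) (s₀ : State)
    (u v : Fin n) (s : State) : Prop where
  mem_eq : s.mem = s₀.mem
  reg_eq : ∀ r < 12, s.reg r = s₀.reg r
  row_u : s.reg 15 = u * n
  row_v : s.reg 16 = v * n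
  le_n : s.reg 14 ≤ n
  le_limit : s.reg 12 ≤ s₀.reg 5
  attained : s.reg 12 < s₀.reg 5 →
    Conflict G es (s₀.reg 9) (s.reg 13) ∧ s₀.mem 5 (s.reg 13) = s.reg 12
  le_price : ∀ w < s.reg 14, ∀ y ≠ 0,
    (s₀.mem 3 (u * n + w) = 0 ∧ s₀.mem 4 (v * n + w) = y) ∨
    (s₀.mem 3 (v * n + w) = 0 ∧ s₀.mem 4 (u * n + w) = y) → s.reg 12 ≤ s₀.mem 5 y

/-- The word size `B` exceeds the positions in the matrices, which are below `n * n`, and all prices,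
sizes and stack heights, which are at most `(m + 1) * (m + 1)`. -/
theorem scanStep_post (hes : G.IsEdgeList es)
    (hB : n * n + (es.length + 1) * (es.length + 1) + 1 < B) {s₀ s : State}
    {u v : Fin n} (h₀ : Ready G es k s₀) (hx : HasLabel es (s₀.reg 9) u v true)
    (h : ScanInv G es s₀ u v s) (hlt : s.reg 14 < n) {Q : State → Prop}
    (hQ : ∀ s', ScanInv G es s₀ u v s' → s'.reg 14 = s.reg 14 + 1 → Q s') :
    scanStep.Post B Q s := by
  have hconf := h₀.conflict_iff hes hx
  have hbound : ∀ a : Fin n, a * n + s.reg 14 < B := fun a => by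
    have := Nat.mul_le_mul_right n (Nat.succ_le_of_lt a.2)
    rw [Nat.succ_mul] at this
    omega
  have hw1 : s.reg 14 + s.reg 4 < B := by
    rw [h.reg_eq 4 (by omega), h₀.reg_one]; have := Nat.le_mul_self n; omega
  have h3 : s.reg 3 = 0 := by rw [h.reg_eq 3 (by omega), h₀.reg_zero]
  have h4 : s.reg 4 = 1 := by rw [h.reg_eq 4 (by omega), h₀.reg_one]
  simp only [scanStep, Program.Post]
  refine ⟨by rw [h.row_u]; exact hbound u, by simpa [h.row_v] using hbound v, ?_⟩
  refine check_post (by omega) (by simpa) fun s₁ m₁ r₁ e₁ le₁ c₁ => ?_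
  refine check_post (by omega) (by rw [r₁ 3 (by omega) (by omega) (by omega)]; simpa)
    fun s₂ m₂ r₂ e₂ le₂ c₂ => ?_
  have hr : ∀ r < 17, r ≠ 12 → r ≠ 13 → s₂.reg r = s.reg r := fun r h1 h2 h3 => by
    rw [r₂ r (by omega) h2 h3, r₁ r (by omega) h2 h3]
    simp [show r ≠ 17 by omega, show r ≠ 18 by omega]
  have h17 : s₁.reg 17 = u * n + s.reg 14 := by
    rw [r₁ 17 (by omega) (by omega) (by omega)]; simp [h.row_u]
  have h18 : s₁.reg 18 = v * n + s.reg 14 := by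
    rw [r₁ 18 (by omega) (by omega) (by omega)]; simp [h.row_v]
  simp only [State.setReg_mem, h.mem_eq] at m₁
  simp only [h17, h18, m₁] at e₂ c₂ m₂
  simp [h.row_u, h.row_v, h.mem_eq] at e₁ c₁ le₁
  rw [hr 14 (by omega) (by omega) (by omega), hr 4 (by omega) (by omega) (by omega)]
  refine ⟨hw1, hQ _ ?_ ?_⟩
  · refine ⟨?_, ?_, ?_, ?_, ?_, ?_, ?_, ?_⟩
    · simpa using m₂
    · intro r hr'
      simp only [State.setReg_reg, show r ≠ 14 by omega, if_false]
      rw [hr r (by omega) (by omega) (by omega), h.reg_eq r hr']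
    · simp [hr, h.row_u]
    · simp [hr, h.row_v]
    · simp [h4]; omega
    · simpa using le₂.trans (le₁.trans h.le_limit)
    · simp only [State.setReg_reg, Nat.reduceEqDiff, if_false]
      intro hlt'
      rcases e₂ with ⟨e, e'⟩ | ⟨a0, b0, e, e'⟩
      · rw [e] at hlt' ⊢
        rw [e']
        rcases e₁ with ⟨e, e'⟩ | ⟨a0, b0, e, e'⟩
        · rw [e] at hlt' ⊢
          rw [e']
          exact h.attained hlt'
        · rw [e, e']
          exact ⟨(hconf _).2 ⟨b0, ⟨s.reg 14, hlt⟩, .inl ⟨a0, rfl⟩⟩, rfl⟩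
      · rw [e, e']
        exact ⟨(hconf _).2 ⟨b0, ⟨s.reg 14, hlt⟩, .inr ⟨a0, rfl⟩⟩, rfl⟩
    · simp only [State.setReg_reg, Nat.reduceEqDiff, if_false, if_true, h4]
      intro w hw y hy hc
      rcases Nat.lt_succ_iff_lt_or_eq.1 hw with hw | rfl
      · exact le₂.trans (le₁.trans (h.le_price w hw y hy hc))
      · rcases hc with ⟨ha, rfl⟩ | ⟨ha, rfl⟩
        · exact le₂.trans (c₁ ha hy)
        · exact c₂ ha hy
  · simp [h4]

theorem scan_wp (hes : G.IsEdgeList es)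
    (hB : n * n + (es.length + 1) * (es.length + 1) + 1 < B) {s : State}
    (h : Ready G es k s) {u v : Fin n} (hx : HasLabel es (s.reg 9) u v true)
    {Q : State → ℕ → Prop} {c : ℕ}
    (hQ : ∀ s', s'.mem = s.mem → (∀ r < 12, s'.reg r = s.reg r) → s'.reg 12 ≤ s.reg 5 →
      (s'.reg 12 < s.reg 5 →
        Conflict G es (s.reg 9) (s'.reg 13) ∧ s.mem 5 (s'.reg 13) = s'.reg 12) →
      (∀ y, Conflict G es (s.reg 9) y → s'.reg 12 ≤ s.mem 5 y) → Q s' c) :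
    Wp B scan Q s (c + 24 * (n + 1)) := by
  have hconf := h.conflict_iff hes hx
  -- the order of the endpoints is the one in the edge list
  wlog hxx : es[s.reg 9 - 1]? = some (u, v, true) generalizing u v
  · exact this hx.symm (h.conflict_iff hes hx.symm) (hx.2.resolve_left hxx)
  obtain ⟨m0, m1, -⟩ := h.mem_edge _ _ _ _ hxx
  have hbound : ∀ a : Fin n, a * n < B := fun a => by
    have := Nat.mul_le_mul_right n (Nat.succ_le_of_lt a.2)
    rw [Nat.succ_mul] at this
    omega
  have hn := u.2
  have hB0 : 0 < B := by omega
  refine Wp.seq ((Wp.of_post (c := c + 24 * n + 1) ?_).mono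
    (by have : scanInit.cost = 8 := rfl
        omega) fun _ _ h => h)
  simp [scanInit, Program.Post, h.reg_n, h.reg_one, m0, m1, hB0, hbound]
  refine Wp.whileLt
    (I := fun s' c' => ScanInv G es s u v s' ∧ c + 24 * (n - s'.reg 14) + 1 ≤ c') ?_ ?_
    ⟨⟨rfl, ?_, by simp, by simp, by simp, by simp, by simp, by simp⟩, by simp⟩
  · rintro s' c' ⟨hI, hc⟩ hlt
    rw [hI.reg_eq 0 (by omega), h.reg_n] at hlt
    have hcost : scanStep.cost ≤ 22 := by decide
    refine ⟨c' - 1, by omega, ?_⟩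
    refine (Wp.of_post (c := c + 24 * (n - s'.reg 14 - 1) + 1)
      (scanStep_post hes hB h hx hI hlt ?_)).mono (by omega) fun _ _ h => h
    intro s'' hI' h14
    exact ⟨hI', by omega⟩
  · rintro s' c' ⟨hI, hc⟩ hlt
    rw [hI.reg_eq 0 (by omega), h.reg_n] at hlt
    refine ⟨c, by omega, hQ s' hI.mem_eq hI.reg_eq hI.le_limit hI.attained fun y hy => ?_⟩
    obtain ⟨h0, w, hw⟩ := (hconf y).1 hy
    exact hI.le_price w (by have := w.2; omega) y h0 hw
  · intro r hr
    simp only [State.setReg_reg]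
    simp only [show r ≠ 12 by omega, show r ≠ 13 by omega, show r ≠ 14 by omega,
      show r ≠ 15 by omega, show r ≠ 16 by omega, show r ≠ 17 by omega, if_false]

end

/-! ### One search -/

section

variable {n : ℕ} {G : TwoColoredGraph (Fin n)} {es : List (Fin n × Fin n × Bool)} {B k : ℕ}
  {L M₀ i : ℕ}

/-- The left vertex in register `9` takes its cheapest neighbor, found by `scan`, and the former
mate of the neighbor, if there is one, becomes the vertex in register `9`. -/
def bid : Program :=
  .add 17 12 4 ;; .store 5 13 17 ;; .load 18 6 13 ;; .store 6 13 9 ;; .copy 9 18 ;;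
  .ifLt 3 9 (.add 10 10 4 ;; .store 8 10 13) (.const 10 0 ;; .const 7 1 ;; .add 8 8 4)

/-- The left vertex in register `9` is stuck: the last exchange is undone, or the search ends. -/
def retreat : Program :=
  .ifLt 3 10 (.load 17 8 10 ;; .sub 10 10 4 ;; .load 18 6 17 ;; .store 6 17 9 ;; .copy 9 18)
    (.store 7 9 3 ;; .const 9 0)

/-- One round of `search`, which lowers the potential. -/
def searchStep : Program := scan ;; .ifLt 12 5 bid retreat

/-- Searches for an augmentation from the left vertex in register `9`. -/
def search : Program := .whileLt 3 9 searchStep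

/-- The loop invariant of `search`. The left vertex in register `9` is `0` if no search is under way.
Register `5` holds the price limit, `6` the number of handled
edges, `7` whether the matching has grown, `8` its size, and `10` the height of the stack; the
arrays `5` to `8` hold the prices, the mates, the flags and the stack. That the stack is no higher
than the sum of the prices keeps its height within a word. -/
structure SearchInv (G : TwoColoredGraph (Fin n)) (es : List (Fin n × Fin n × Bool))
    (k L M₀ i : ℕ) (s : State) : Prop where
  ready : Ready G es k s
  limit : s.reg 5 = L
  index : s.reg 6 = i
  pass : PassInv (Conflict G es) es.length L M₀ i (s.mem 6) (s.mem 5) (s.mem 7) (s.mem 8)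
    (s.reg 9) (s.reg 10) (s.reg 7) (s.reg 8)
  red : s.reg 9 ≠ 0 → ∃ u v, HasLabel es (s.reg 9) u v true
  stack_le : s.reg 10 ≤ ∑ y ∈ Icc 1 es.length, s.mem 5 y

/-- A bound on the number of rounds that are left: a bid raises a price, and pays for being
undone. -/
def potential (m L : ℕ) (s : State) : ℕ :=
  2 * (m * L - ∑ y ∈ Icc 1 m, s.mem 5 y) + s.reg 10 + if s.reg 9 = 0 then 0 else 1

theorem exists_red_of_conflict {x y : ℕ} (h : Conflict G es x y) :
    ∃ u v, HasLabel es x u v true := by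
  obtain ⟨u, v, w, -, hx, -⟩ := h
  exact ⟨u, v, hx⟩

theorem bid_post (hB : n * n + (es.length + 1) * (es.length + 1) + 1 < B) (hL : L ≤ es.length + 1)
    {s : State} (h : SearchInv G es k L M₀ i s) (hc : s.reg 9 ≠ 0) (h12 : s.reg 12 < L)
    (hadj : Conflict G es (s.reg 9) (s.reg 13)) (h13 : s.mem 5 (s.reg 13) = s.reg 12)
    (hmin : ∀ y, Conflict G es (s.reg 9) y → s.reg 12 ≤ s.mem 5 y) {Q : State → Prop}
    (hQ : ∀ s', SearchInv G es k L M₀ i s' →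
      potential es.length L s' + 1 ≤ potential es.length L s → Q s') : bid.Post B Q s := by
  have hbd := fun x y (h : Conflict G es x y) => h.bounds
  have h1 := h.ready.reg_one
  have h3 := h.ready.reg_zero
  rw [← h13] at h12 hmin
  have hb13 := (hbd _ _ hadj).2.2
  have hsum := sum_update_succ (s.mem 5) hb13.1 hb13.2
  have hmm : es.length * L ≤ (es.length + 1) * (es.length + 1) - (es.length + 1) := by
    rw [Nat.succ_mul, Nat.add_sub_cancel]
    exact Nat.mul_le_mul_left _ hL
  have hle := h.pass.sum_price_le
  have hst := h.stack_le
  have hm2 := Nat.le_mul_self (es.length + 1)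
  have hM : s.reg 8 ≤ es.length := by
    rw [h.pass.size]
    exact (card_filter_le _ _).trans (by simp)
  simp only [bid, Program.Post, State.setReg_reg, State.setReg_mem, State.setMem_reg,
    State.setMem_mem, h1, h3, ← h13]
  simp
  refine ⟨by omega, fun hold => ?_, fun hold => ⟨by omega, by omega, by omega, ?_⟩⟩
  · have hp := h.pass.exchange hc hadj h12 hmin hold.ne'
    have hle' := hp.sum_price_le
    refine ⟨by omega, hQ _ ⟨h.ready.of_eq (by simp) (by simp), ?_, ?_, ?_, ?_, ?_⟩ ?_⟩
    · simpa using h.limit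
    · simpa using h.index
    · simpa using hp
    · intro _
      simpa using exists_red_of_conflict (h.pass.adj_mate _ hold.ne')
    · simp [hsum]; omega
    · simp [potential, hsum, hold.ne', hc]; omega
  · have hp := h.pass.augment hbd hc hadj h12 hmin hold
    have hle' := hp.sum_price_le
    refine hQ _ ⟨h.ready.of_eq (by simp) (by simp), ?_, ?_, ?_, ?_, ?_⟩ ?_
    · simpa using h.limit
    · simpa using h.index
    · simpa [hold] using hp
    · simp [hold]
    · simp
    · simp [potential, hsum, hold, hc]; omega

theorem retreat_post (hB : n * n + (es.length + 1) * (es.length + 1) + 1 < B)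
    {s : State} (h : SearchInv G es k L M₀ i s) (hc : s.reg 9 ≠ 0)
    (hs : Stuck (Conflict G es) L (s.mem 5) (s.reg 9)) {Q : State → Prop}
    (hQ : ∀ s', SearchInv G es k L M₀ i s' →
      potential es.length L s' + 1 ≤ potential es.length L s → Q s') : retreat.Post B Q s := by
  have h1 := h.ready.reg_one
  have h3 := h.ready.reg_zero
  simp only [retreat, Program.Post, State.setReg_reg, State.setReg_mem, State.setMem_reg,
    h1, h3]
  simp
  refine ⟨fun hsp => ?_, fun hsp => ⟨by omega, ?_⟩⟩
  · obtain ⟨sp, hsp⟩ : ∃ sp, s.reg 10 = sp + 1 := ⟨s.reg 10 - 1, by omega⟩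
    have hp := h.pass
    rw [hsp] at hp
    have hmate := hp.undoable.2.1
    have hred := exists_red_of_conflict (hp.adj_mate _ hmate)
    replace hp := hp.backtrack hc hs
    have hle := h.stack_le
    rw [hsp]
    refine hQ _ ⟨h.ready.of_eq (by simp) (by simp), ?_, ?_, ?_, ?_, ?_⟩ ?_
    · simpa using h.limit
    · simpa using h.index
    · simpa using hp
    · intro _
      simpa using hred
    · simp; omega
    · simp [potential, hc, hsp, hmate]
  · have hp := h.pass
    rw [hsp] at hp
    replace hp := hp.giveUp hc hs
    refine hQ _ ⟨h.ready.of_eq (by simp) (by simp), ?_, ?_, ?_, ?_, ?_⟩ ?_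
    · simpa using h.limit
    · simpa using h.index
    · simpa [hsp] using hp
    · simp
    · simp [hsp]
    · simp [potential, hc, hsp]

theorem SearchInv.of_eq {s s' : State} (h : SearchInv G es k L M₀ i s) (hm : s'.mem = s.mem)
    (hr : ∀ r < 12, s'.reg r = s.reg r) : SearchInv G es k L M₀ i s' where
  ready := h.ready.of_eq (by simp [hr]) (by simp [hm])
  limit := by rw [hr 5 (by omega), h.limit]
  index := by rw [hr 6 (by omega), h.index]
  pass := by
    rw [hm, hr 7 (by omega), hr 8 (by omega), hr 9 (by omega), hr 10 (by omega)]
    exact h.pass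
  red := by rw [hr 9 (by omega)]; exact h.red
  stack_le := by rw [hm, hr 10 (by omega)]; exact h.stack_le

theorem searchStep_wp (hes : G.IsEdgeList es)
    (hB : n * n + (es.length + 1) * (es.length + 1) + 1 < B) (hL : L ≤ es.length + 1) {s : State}
    (h : SearchInv G es k L M₀ i s) (hc : s.reg 9 ≠ 0) {Q : State → ℕ → Prop} {c : ℕ}
    (hQ : ∀ s', SearchInv G es k L M₀ i s' →
      potential es.length L s' + 1 ≤ potential es.length L s → Q s' c) :
    Wp B searchStep Q s (c + 39 * (n + 1)) := by
  obtain ⟨u, v, hx⟩ := h.red hc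
  refine Wp.seq ((scan_wp (c := c + 15) hes hB h.ready hx ?_).mono (by omega) fun _ _ h => h)
  intro s' hm hr hle hatt hmin
  have h' := h.of_eq hm hr
  have hpot : potential es.length L s' = potential es.length L s := by
    simp [potential, hm, hr]
  have h9 := hr 9 (by omega)
  have h5 := hr 5 (by omega)
  rw [← hpot] at hQ
  rw [← h9] at hatt hmin hc
  rw [← h5] at hatt hle
  rw [← hm] at hatt hmin
  have hcost : (Program.ifLt 12 5 bid retreat).cost ≤ 15 := by decide
  refine (Wp.of_post (c := c) ?_).mono (by omega) fun _ _ h => h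
  rw [Program.Post]
  refine ⟨fun hlt => ?_, fun hlt => ?_⟩
  · obtain ⟨ha, hb⟩ := hatt hlt
    exact bid_post hB hL h' hc (hlt.trans_eq h'.limit) ha hb hmin hQ
  · refine retreat_post hB h' hc (fun y hy => ?_) hQ
    have := hmin y hy
    have := h'.limit
    omega

/-- Each unit of potential that a search uses up is paid with `40 * (n + 1)` credits. -/
theorem search_wp (hes : G.IsEdgeList es)
    (hB : n * n + (es.length + 1) * (es.length + 1) + 1 < B) (hL : L ≤ es.length + 1) {s : State}
    (h : SearchInv G es k L M₀ i s) {Q : State → ℕ → Prop} {c d : ℕ}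
    (hd : c + 40 * (n + 1) * potential es.length L s + 1 ≤ d)
    (hQ : ∀ s' d', SearchInv G es k L M₀ i s' → s'.reg 9 = 0 →
      c + 40 * (n + 1) * potential es.length L s' ≤ d' → Q s' d') :
    Wp B search Q s d := by
  refine Wp.whileLt (I := fun s' d' => SearchInv G es k L M₀ i s' ∧
    c + 40 * (n + 1) * potential es.length L s' + 1 ≤ d') ?_ ?_ ⟨h, hd⟩
  · rintro s' d' ⟨hI, hd'⟩ hlt
    rw [hI.ready.reg_zero] at hlt
    obtain ⟨e, rfl⟩ : ∃ e, d' = e + 40 * (n + 1) := by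
      refine ⟨d' - 40 * (n + 1), ?_⟩
      have : 1 ≤ potential es.length L s' := by
        simp [potential, hlt.ne']
      have := Nat.mul_le_mul_left (40 * (n + 1)) this
      omega
    refine ⟨e + 39 * (n + 1), by omega, searchStep_wp hes hB hL hI hlt.ne' fun s'' hI' hpot => ?_⟩
    have := Nat.mul_le_mul_left (40 * (n + 1)) hpot
    rw [Nat.mul_succ] at this
    exact ⟨hI', by omega⟩
  · rintro s' d' ⟨hI, hd'⟩ hlt
    rw [hI.ready.reg_zero] at hlt
    exact ⟨d' - 1, by omega, hQ _ _ hI (by omega) (by omega)⟩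

end

/-! ### One pass -/

section

variable {n : ℕ} {G : TwoColoredGraph (Fin n)} {es : List (Fin n × Fin n × Bool)} {B k : ℕ}
  {L M₀ i : ℕ}

/-- Searches from the next edge if it is red and unmatched. -/
def visit : Program :=
  (.load 17 2 6 ;; .add 6 6 4) ;; .ifLt 3 17
    (.load 18 7 6 ;; .ifLt 3 18 .skip ((.store 7 6 4 ;; .copy 9 6) ;; search)) .skip

/-- Resets the next price. -/
def resetStep : Program := .add 6 6 4 ;; .store 5 6 3

/-- A search from each unmatched red edge, with the price limit in register `5`. -/
def pass : Program :=
  (.const 7 0 ;; .const 6 0) ;; .whileLt 6 1 resetStep ;; .const 6 0 ;; .whileLt 6 1 visit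

theorem visit_wp (hes : G.IsEdgeList es)
    (hB : n * n + (es.length + 1) * (es.length + 1) + 1 < B) (hL : L ≤ es.length + 1) {s : State}
    (h : SearchInv G es k L M₀ i s) (hc : s.reg 9 = 0) (hi : i < es.length)
    {Q : State → ℕ → Prop} {c d : ℕ}
    (hd : c + 40 * (n + 1) * potential es.length L s + 40 * (n + 1) + 8 ≤ d)
    (hQ : ∀ s' d', SearchInv G es k L M₀ (i + 1) s' → s'.reg 9 = 0 →
      c + 40 * (n + 1) * potential es.length L s' ≤ d' → Q s' d') :
    Wp B visit Q s d := by
  have h1 := h.ready.reg_one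
  have h3 := h.ready.reg_zero
  have h6 := h.index
  obtain ⟨u, v, b, he⟩ : ∃ u v b, es[i]? = some (u, v, b) :=
    ⟨_, _, _, List.getElem?_eq_getElem hi⟩
  have hlab : HasLabel es (i + 1) u v b := ⟨by omega, .inl he⟩
  have hcol := (h.ready.mem_edge _ _ _ _ he).2.2
  have hm2 := Nat.le_mul_self (es.length + 1)
  refine Wp.seq ((Wp.of_post (c := d - 2) ?_).mono (c := d - 2 + 2) (by omega) fun _ _ h => h)
  simp only [Program.Post, State.setReg_reg, h1, h6, hcol]
  simp
  refine ⟨by omega, ?_⟩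
  have hpass := h.pass
  rw [hc] at hpass
  -- the edge is matched or blue, and only scratch registers and the counter have changed
  have hskip : s.mem 7 (i + 1) ≠ 0 ∨ Stuck (Conflict G es) L (s.mem 5) (i + 1) → ∀ a d',
      d - 10 ≤ d' → Q (((s.setReg 17 (if b then 1 else 0)).setReg 6 (i + 1)).setReg 18 a) d' ∧
        Q ((s.setReg 17 (if b then 1 else 0)).setReg 6 (i + 1)) d' := by
    intro hs a d' hd'
    have hp := hpass.skip hs
    refine ⟨hQ _ _ ⟨h.ready.of_eq (by simp) (by simp), ?_, ?_, ?_, ?_, ?_⟩ ?_ ?_,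
      hQ _ _ ⟨h.ready.of_eq (by simp) (by simp), ?_, ?_, ?_, ?_, ?_⟩ ?_ ?_⟩
    all_goals first
      | (simp [hc, h.limit, h.stack_le]; done)
      | (simpa [hc] using hp)
      | skip
    all_goals
      simp only [potential] at hd ⊢
      simp
      omega
  refine (Wp.ifLt (c := d - 3) (fun hb => ?_) (fun hb => ?_)).mono (by omega) fun _ _ h => h
  · refine Wp.seq ((Wp.of_post (c := d - 4) ?_).mono (c := d - 4 + 1) (by omega) fun _ _ h => h)
    simp only [Program.Post, State.setReg_reg, State.setReg_mem]
    simp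
    refine (Wp.ifLt (c := d - 5) (fun hf => ?_) (fun hf => ?_)).mono (by omega) fun _ _ h => h
    · refine (Wp.of_post (c := d - 6) ?_).mono (c := d - 6 + 1) (by omega) fun _ _ h => h
      simp [h3] at hf
      exact (hskip (.inl hf.ne') _ _ (by omega)).1
    · refine Wp.seq ((Wp.of_post (c := d - 7) ?_).mono (c := d - 7 + 2) (by omega) fun _ _ h => h)
      simp [h3] at hf hb
      have hp := hpass.start hf
      simp [Program.Post, h1]
      refine search_wp (c := c) (k := k) (M₀ := M₀) (i := i + 1) hes hB hL
        ⟨h.ready.of_eq (by simp) (by simp), ?_, ?_, ?_, ?_, ?_⟩ ?_ hQ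
      · simpa using h.limit
      · simp
      · simpa [h1] using hp
      · intro _
        refine ⟨u, v, ?_⟩
        cases b
        · simp at hb
        · simpa using hlab
      · simpa using h.stack_le
      · simp [potential, hc, Nat.mul_add] at hd ⊢
        omega
  · refine (Wp.of_post (c := d - 4) ?_).mono (c := d - 4 + 1) (by omega) fun _ _ h => h
    simp [h3] at hb
    refine (hskip (.inr ?_) 0 _ (by omega)).2
    rintro y ⟨u', v', w, -, hx, -⟩
    rw [(hlab.edge_eq hx).2] at hb
    simp at hb

/-- The state between two passes. -/
structure Idle (G : TwoColoredGraph (Fin n)) (es : List (Fin n × Fin n × Bool)) (k : ℕ)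
    (s : State) : Prop where
  ready : Ready G es k s
  matching : IsMatching (Conflict G es) es.length (s.mem 6) (s.mem 7) 0 (s.reg 8)
  reg_cur : s.reg 9 = 0
  reg_stack : s.reg 10 = 0
  price_eq_zero : ∀ y, y = 0 ∨ es.length < y → s.mem 5 y = 0

/-- A bound on the number of steps of a pass. -/
def passCost (n m L : ℕ) : ℕ := 40 * (n + 1) * (2 * (m * L)) + (40 * (n + 1) + 13) * m + 6

theorem resetLoop_wp (hB : n * n + (es.length + 1) * (es.length + 1) + 1 < B) {s : State}
    (h : Idle G es k s) (h6 : s.reg 6 = 0) {Q : State → ℕ → Prop} {d : ℕ}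
    (hQ : ∀ s', Idle G es k s' → (∀ y, s'.mem 5 y = 0) → (∀ r ≠ 6, s'.reg r = s.reg r) → Q s' d) :
    Wp B (.whileLt 6 1 resetStep) Q s (d + 4 * es.length + 1) := by
  refine Wp.whileLt (I := fun s' d' => Idle G es k s' ∧ s'.reg 6 ≤ es.length ∧
    (∀ y ≤ s'.reg 6, s'.mem 5 y = 0) ∧ (∀ r ≠ 6, s'.reg r = s.reg r) ∧
    d + 4 * (es.length - s'.reg 6) + 1 ≤ d') ?_ ?_ ⟨h, by omega, ?_, fun _ _ => rfl, by omega⟩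
  · rintro s' d' ⟨hI, hle, hz, hr, hd⟩ hlt
    have h1 := hI.ready.reg_one
    have h3 := hI.ready.reg_zero
    have hm2 := Nat.le_mul_self (es.length + 1)
    rw [hI.ready.reg_m] at hlt
    refine ⟨d' - 1, by omega, (Wp.of_post (c := d' - 3) ?_).mono (c := d' - 3 + 2)
      (by omega) fun _ _ h => h⟩
    simp only [resetStep, Program.Post, State.setReg_reg, h1]
    simp [h3]
    refine ⟨by omega, ⟨hI.ready.of_eq (by simp) (by simp), ?_, ?_, ?_, ?_⟩, hlt, ?_, ?_, by omega⟩
    · simpa using hI.matching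
    · simpa using hI.reg_cur
    · simpa using hI.reg_stack
    · intro y hy
      have := hI.price_eq_zero y hy
      simp [Function.update_apply, this]
    · intro y hy
      obtain rfl | hy' := eq_or_ne y (s'.reg 6 + 1)
      · simp
      · simpa [hy'] using hz y (by omega)
    · intro r hr'
      simpa [hr'] using hr r hr'
  · rintro s' d' ⟨hI, hle, hz, hr, hd⟩ hlt
    rw [hI.ready.reg_m] at hlt
    refine ⟨d, by omega, hQ s' hI (fun y => ?_) hr⟩
    rcases le_or_gt y (s'.reg 6) with hy | hy
    · exact hz y hy
    · exact hI.price_eq_zero y (.inr (by omega))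
  · intro y hy
    exact h.price_eq_zero y (.inl (by omega))

/-- The outcome of a pass. Without an augmentation there is a cover that proves the matching to be
maximum; in any case the matching is at most `L` smaller than some cover, if `m ≤ L * L`. -/
theorem pass_wp (hes : G.IsEdgeList es)
    (hB : n * n + (es.length + 1) * (es.length + 1) + 1 < B) (hL1 : 1 ≤ L)
    (hL : L ≤ es.length + 1) {s : State} (h : Idle G es k s) (h5 : s.reg 5 = L)
    {Q : State → ℕ → Prop} {d : ℕ}
    (hQ : ∀ s', Idle G es k s' → (s'.reg 7 = 0 → HasCover (Conflict G es) (s'.reg 8)) →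
      (s'.reg 7 ≠ 0 → s.reg 8 < s'.reg 8) → s.reg 8 ≤ s'.reg 8 → s'.reg 5 = L →
      (es.length ≤ L * L → HasCover (Conflict G es) (s'.reg 8 + L)) → Q s' d) :
    Wp B pass Q s (d + passCost n es.length L) := by
  have hbd := fun x y (h : Conflict G es x y) => h.bounds
  unfold passCost
  set P := 40 * (n + 1) * (2 * (es.length * L))
  refine Wp.seq ((Wp.of_post (c := d + P + (40 * (n + 1) + 13) * es.length + 4) ?_).mono
    (c := d + P + (40 * (n + 1) + 13) * es.length + 4 + 2) (by omega) fun _ _ h => h)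
  simp [Program.Post]
  refine ⟨by omega, ?_⟩
  refine Wp.seq ((resetLoop_wp (G := G) (d := d + P + (40 * (n + 1) + 9) * es.length + 2)
    (s := (s.setReg 7 0).setReg 6 0) (k := k) hB ?_ (by simp) ?_).mono ?_ fun _ _ h => h)
  · exact ⟨h.ready.of_eq (by simp) (by simp), by simpa using h.matching, by simpa using h.reg_cur,
      by simpa using h.reg_stack, by simpa using h.price_eq_zero⟩
  · intro s₁ h₁ hz hr
    simp at hr
    refine Wp.seq ((Wp.of_post (c := d + P + (40 * (n + 1) + 9) * es.length + 1) ?_).mono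
      (c := d + P + (40 * (n + 1) + 9) * es.length + 1 + 1) (by omega) fun _ _ h => h)
    simp [Program.Post]
    refine ⟨by omega, ?_⟩
    have hz' : s₁.mem 5 = fun _ => 0 := funext hz
    have hpot : potential es.length L (s₁.setReg 6 0) = 2 * (es.length * L) := by
      simp [potential, hz, h₁.reg_stack, h₁.reg_cur]
    have hP : 40 * (n + 1) * potential es.length L (s₁.setReg 6 0) = P := by rw [hpot]
    refine Wp.whileLt (I := fun s' d' => SearchInv G es k L (s.reg 8) (s'.reg 6) s' ∧
      s'.reg 9 = 0 ∧ s'.reg 6 ≤ es.length ∧ d + 40 * (n + 1) * potential es.length L s' +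
        (40 * (n + 1) + 9) * (es.length - s'.reg 6) + 1 ≤ d') ?_ ?_
      ⟨⟨h₁.ready.of_eq (by simp) (by simp), ?_, by simp, ?_, ?_, ?_⟩, ?_, by simp, ?_⟩
    · rintro s' d' ⟨hI, h9, hle, hd⟩ hlt
      rw [hI.ready.reg_m] at hlt
      obtain ⟨e, he⟩ : ∃ e, es.length - s'.reg 6 = e + 1 := ⟨es.length - s'.reg 6 - 1, by omega⟩
      rw [he, Nat.mul_succ (40 * (n + 1) + 9)] at hd
      refine ⟨d' - 1, by omega, visit_wp (c := d + (40 * (n + 1) + 9) * e + 1) hes hB hL hI h9 hlt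
        (by omega) fun s'' d'' hI' h9' hd' => ?_⟩
      have h6 := hI'.index
      rw [← h6] at hI'
      refine ⟨hI', h9', by omega, ?_⟩
      rw [h6, show es.length - (s'.reg 6 + 1) = e by omega]
      omega
    · rintro s' d' ⟨hI, h9, hle, hd⟩ hlt
      rw [hI.ready.reg_m] at hlt
      have hp := hI.pass
      rw [h9, show s'.reg 6 = es.length by omega] at hp
      have hsp := hp.stack_empty rfl
      refine ⟨d, by omega, hQ s' ⟨hI.ready, hp.toIsMatching, h9, hsp, ?_⟩
        (hp.hasCover_of_not_grown hbd hL1) hp.grown hp.le_size hI.limit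
        (hp.exists_hasCover hbd hL1)⟩
      intro y hy
      by_contra hy0
      have := hbd _ _ (hp.adj_mate y (hp.matched_of_pos y hy0))
      omega
    · simpa [hr] using h5
    · have := h₁.matching.passInv (L := L) (stk := s₁.mem 8) hL1
      simpa [hz', hr, h.reg_cur, h.reg_stack] using this
    · simp [h₁.reg_cur]
    · simp [h₁.reg_stack]
    · simp [h₁.reg_cur]
    · rw [hP]; simp
  · simp only [Nat.add_mul]; omega

end

/-! ### Setting up the matrices and the price limit -/

section

variable {n : ℕ} {G : TwoColoredGraph (Fin n)} {es : List (Fin n × Fin n × Bool)} {B k : ℕ}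
  {i : ℕ}

/-- Enters the next edge into the adjacency matrix and, if it is blue, its label into the matrix
of the blue edges. -/
def readStep : Program :=
  .load 15 0 6 ;; .load 16 1 6 ;; .load 17 2 6 ;; .mul 18 15 0 ;; .add 18 18 16 ;;
  .mul 19 16 0 ;; .add 19 19 15 ;; .add 6 6 4 ;; .store 3 18 4 ;; .store 3 19 4 ;;
  .ifLt 3 17 .skip (.store 4 18 6 ;; .store 4 19 6)

/-- Increases the candidate in register `5` for the square root of `m` rounded up. -/
def rootStep : Program := .add 5 5 4 ;; .mul 17 5 5

/-- Reads the edge list and puts the square root of `m`, rounded up, into register `5`. -/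
def setup : Program :=
  .const 4 1 ;; .whileLt 6 1 readStep ;; (.const 5 1 ;; .const 17 1) ;; .whileLt 17 1 rootStep

/-- The first `i` edges have been read. A `0` marks the positions of the matrices without an
edge. -/
structure ReadInv (es : List (Fin n × Fin n × Bool)) (k i : ℕ) (s : State) : Prop where
  reg_n : s.reg 0 = n
  reg_m : s.reg 1 = es.length
  reg_k : s.reg 2 = k
  reg_zero : s.reg 3 = 0
  reg_one : s.reg 4 = 1
  reg_index : s.reg 6 = i
  reg_rest : s.reg 8 = 0 ∧ s.reg 9 = 0 ∧ s.reg 10 = 0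
  mem_edge : ∀ (i : ℕ) (u v : Fin n) (c : Bool), es[i]? = some (u, v, c) →
    s.mem 0 i = u ∧ s.mem 1 i = v ∧ s.mem 2 i = if c then 1 else 0
  mem_adj : ∀ u v : Fin n, s.mem 3 (u * n + v) ≠ 0 ↔ ∃ x c, x ≤ i ∧ HasLabel es x u v c
  mem_blue : ∀ (u v : Fin n) (y : ℕ),
    s.mem 4 (u * n + v) = y ∧ y ≠ 0 ↔ y ≤ i ∧ HasLabel es y u v false
  mem_rest : s.mem 5 = (fun _ => 0) ∧ s.mem 6 = (fun _ => 0) ∧ s.mem 7 = (fun _ => 0)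

/-- The positions of a row-major `n × n` matrix are distinct. -/
theorem position_inj (u v u' v' : Fin n) :
    (u * n + v : ℕ) = u' * n + v' ↔ u = u' ∧ v = v' := by
  constructor
  · intro h
    have hn : 0 < n := by have := u.2; omega
    have h1 := congrArg (· / n) h
    have h2 := congrArg (· % n) h
    simp only [Nat.mul_add_mod_self_right, Nat.mod_eq_of_lt v.2, Nat.mod_eq_of_lt v'.2] at h2
    simp only [Nat.mul_comm _ n, Nat.mul_add_div hn, Nat.div_eq_of_lt v.2,
      Nat.div_eq_of_lt v'.2] at h1
    exact ⟨Fin.ext h1, Fin.ext h2⟩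
  · rintro ⟨rfl, rfl⟩; rfl

theorem hasLabel_succ_iff {a b u v : Fin n} {c c' : Bool} (he : es[i]? = some (a, b, c)) :
    HasLabel es (i + 1) u v c' ↔ c' = c ∧ (u = a ∧ v = b ∨ u = b ∧ v = a) := by
  simp only [HasLabel, Nat.add_sub_cancel, he, Option.some.injEq, Prod.mk.injEq]
  grind

theorem update_update_position (f : ℕ → ℕ) (a b u v : Fin n) (z : ℕ) :
    update (update f (a * n + b) z) (b * n + a) z (u * n + v) =
      if u = a ∧ v = b ∨ u = b ∧ v = a then z else f (u * n + v) := by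
  simp only [Function.update_apply, position_inj]
  grind

theorem readStep_post (hes : G.IsEdgeList es)
    (hB : n * n + (es.length + 1) * (es.length + 1) + 1 < B) {s : State}
    (h : ReadInv es k i s) (hi : i < es.length) {Q : State → Prop}
    (hQ : ∀ s', ReadInv es k (i + 1) s' → Q s') : readStep.Post B Q s := by
  obtain ⟨a, b, c, he⟩ : ∃ u v b, es[i]? = some (u, v, b) :=
    ⟨_, _, _, List.getElem?_eq_getElem hi⟩
  obtain ⟨m0, m1, m2⟩ := h.mem_edge _ _ _ _ he
  have hlab : HasLabel es (i + 1) a b c := ⟨by omega, .inl he⟩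
  have ha := Nat.mul_le_mul_right n (Nat.succ_le_of_lt a.2)
  have hb := Nat.mul_le_mul_right n (Nat.succ_le_of_lt b.2)
  have hm2 := Nat.le_mul_self (es.length + 1)
  have h2a := a.2
  have h2b := b.2
  rw [Nat.succ_mul] at ha hb
  have hle : ∀ x, x ≤ i + 1 ↔ x ≤ i ∨ x = i + 1 := by omega
  -- the properties of the final state, whatever the scratch registers hold
  have hinv : ∀ r₁₅ r₁₆ r₁₇ r₁₈ r₁₉ s', s'.reg = ((((((s.setReg 15 r₁₅).setReg 16 r₁₆).setReg 17
      r₁₇).setReg 18 r₁₈).setReg 19 r₁₉).setReg 6 (i + 1)).reg → s'.mem 0 = s.mem 0 →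
      s'.mem 1 = s.mem 1 → s'.mem 2 = s.mem 2 → s'.mem 5 = s.mem 5 → s'.mem 6 = s.mem 6 →
      s'.mem 7 = s.mem 7 → s'.mem 3 = update (update (s.mem 3) (a * n + b) 1) (b * n + a) 1 →
      (s'.mem 4 = if c then s.mem 4 else
        update (update (s.mem 4) (a * n + b) (i + 1)) (b * n + a) (i + 1)) → Q s' := by
    intro r₁₅ r₁₆ r₁₇ r₁₈ r₁₉ s' hr e0 e1 e2 e5 e6 e7 e3 e4
    refine hQ s' ⟨?_, ?_, ?_, ?_, ?_, ?_, ?_, ?_, ?_, ?_, ?_⟩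
    · simp [hr, h.reg_n]
    · simp [hr, h.reg_m]
    · simp [hr, h.reg_k]
    · simp [hr, h.reg_zero]
    · simp [hr, h.reg_one]
    · simp [hr]
    · simpa [hr] using h.reg_rest
    · rw [e0, e1, e2]; exact h.mem_edge
    · intro u v
      rw [e3, update_update_position]
      simp only [hle, or_and_right, exists_or, exists_and_left, exists_eq_left,
        hasLabel_succ_iff he]
      have := h.mem_adj u v
      simp only [exists_and_left] at this
      rw [← this]
      split_ifs with hc <;> simp [hc]
    · intro u v y
      have hold := h.mem_blue u v y
      by_cases hc : (c = false ∧ (u = a ∧ v = b ∨ u = b ∧ v = a))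
      · have hnew : HasLabel es (i + 1) u v false :=
          (hasLabel_succ_iff he).2 ⟨hc.1.symm, hc.2⟩
        rw [e4, hc.1]
        simp only [Bool.false_eq_true, if_false, update_update_position, hc.2, if_true]
        constructor
        · rintro ⟨rfl, -⟩
          exact ⟨le_rfl, hnew⟩
        · rintro ⟨-, hy⟩
          exact ⟨(hnew.eq hes hy).1, by have := hy.1; omega⟩
      · have hsame : s'.mem 4 (u * n + v) = s.mem 4 (u * n + v) := by
          rw [e4]
          cases c
          · simp only [Bool.false_eq_true, if_false, update_update_position]
            simp only [true_and] at hc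
            rw [if_neg hc]
          · simp
        rw [hsame, hold, hle]
        constructor
        · exact fun ⟨h1, h2⟩ => ⟨.inl h1, h2⟩
        · rintro ⟨h1 | rfl, h2⟩
          · exact ⟨h1, h2⟩
          · have := (hasLabel_succ_iff he).1 h2
            exact absurd ⟨this.1.symm, this.2⟩ hc
    · rw [e5, e6, e7]; exact h.mem_rest
  simp only [readStep, Program.Post, State.setReg_reg, State.setReg_mem, State.setMem_reg,
    h.reg_index, h.reg_n, h.reg_one, h.reg_zero]
  simp only [Nat.reduceEqDiff, if_true, if_false, m0, m1, m2]
  refine ⟨by omega, by omega, by omega, by omega, by omega, fun hc => ?_, fun hc => ?_⟩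
  · cases c
    · simp at hc
    · refine hinv a b 1 (a * n + b) (b * n + a) _ ?_ ?_ ?_ ?_ ?_ ?_ ?_ ?_ ?_
      all_goals simp
      funext r
      simp
      grind
  · cases c
    · refine hinv a b 0 (a * n + b) (b * n + a) _ ?_ ?_ ?_ ?_ ?_ ?_ ?_ ?_ ?_
      all_goals simp
      funext r
      simp
      grind
    · simp at hc

theorem readInv_input (es : List (Fin n × Fin n × Bool)) (k : ℕ) :
    ReadInv es k 0 ((inputBPD es k).setReg 4 1) where
  reg_n := rfl
  reg_m := rfl
  reg_k := rfl
  reg_zero := rfl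
  reg_one := rfl
  reg_index := rfl
  reg_rest := ⟨rfl, rfl, rfl⟩
  mem_edge := by
    intro i u v c h
    simp [inputBPD, h]
  mem_adj := by
    intro u v
    have : ∀ i, (inputBPD es k).mem 3 i = 0 := fun i => by simp [inputBPD]
    simp only [State.setReg_mem, this]
    constructor
    · simp
    · rintro ⟨x, c, h0, hx⟩
      have := hx.1
      omega
  mem_blue := by
    intro u v y
    have : ∀ i, (inputBPD es k).mem 4 i = 0 := fun i => by simp [inputBPD]
    simp only [State.setReg_mem, this]
    constructor
    · rintro ⟨rfl, h⟩; exact absurd rfl h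
    · rintro ⟨h0, hx⟩
      have := hx.1
      omega
  mem_rest := by
    refine ⟨?_, ?_, ?_⟩ <;> funext i <;> simp [inputBPD]

theorem ReadInv.idle (hes : G.IsEdgeList es) {s : State} (h : ReadInv es k es.length s) :
    Idle G es k s where
  ready :=
    { reg_n := h.reg_n
      reg_m := h.reg_m
      reg_k := h.reg_k
      reg_zero := h.reg_zero
      reg_one := h.reg_one
      mem_edge := h.mem_edge
      mem_adj := by
        intro u v
        rw [h.mem_adj, graph_adj_iff hes]
        exact ⟨fun ⟨x, c, _, hx⟩ => ⟨x, c, hx⟩, fun ⟨x, c, hx⟩ => ⟨x, c, hx.le_length, hx⟩⟩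
      mem_blue := by
        intro u v y
        rw [h.mem_blue]
        exact ⟨fun hx => hx.2, fun hx => ⟨hx.le_length, hx⟩⟩ }
  matching := by
    rw [h.mem_rest.2.1, h.mem_rest.2.2, h.reg_rest.1]
    exact .empty
  reg_cur := h.reg_rest.2.1
  reg_stack := h.reg_rest.2.2
  price_eq_zero := by simp [h.mem_rest.1]

/-- The square root of `m`, rounded up, but at least `1`. -/
def IsCeilSqrt (m L : ℕ) : Prop := 1 ≤ L ∧ m ≤ L * L ∧ (L = 1 ∨ (L - 1) * (L - 1) < m)

theorem IsCeilSqrt.exists (m : ℕ) : ∃ L, IsCeilSqrt m L := by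
  have h1 := Nat.sqrt_le (m - 1)
  have h2 := Nat.lt_succ_sqrt (m - 1)
  rw [Nat.succ_eq_add_one] at h2
  refine ⟨Nat.sqrt (m - 1) + 1, by omega, by omega, ?_⟩
  rcases Nat.eq_zero_or_pos m with rfl | hm
  · exact .inl rfl
  · exact .inr (by rw [Nat.add_sub_cancel]; omega)

theorem IsCeilSqrt.eq {m L L' : ℕ} (h : IsCeilSqrt m L) (h' : IsCeilSqrt m L') : L = L' := by
  have key : ∀ {a b}, IsCeilSqrt m a → IsCeilSqrt m b → a ≤ b := by
    rintro a b ⟨-, -, ha⟩ ⟨hb1, hb, -⟩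
    by_contra! hab
    have := Nat.mul_le_mul (show b ≤ a - 1 by omega) (show b ≤ a - 1 by omega)
    omega
  exact le_antisymm (key h h') (key h' h)

theorem IsCeilSqrt.le_succ {m L : ℕ} (h : IsCeilSqrt m L) : L ≤ m + 1 := by
  obtain ⟨h1, -, rfl | h3⟩ := h
  · omega
  · have := Nat.le_mul_self (L - 1)
    omega

theorem setup_wp (hes : G.IsEdgeList es)
    (hB : n * n + (es.length + 1) * (es.length + 1) + 1 < B) {Q : State → ℕ → Prop} {d : ℕ}
    (hQ : ∀ s L, Idle G es k s → s.reg 5 = L → s.reg 8 = 0 → IsCeilSqrt es.length L → Q s d) :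
    Wp B setup Q (inputBPD es k) (d + 19 * es.length + 8) := by
  have hcost : readStep.cost ≤ 14 := by decide
  refine Wp.seq ((Wp.of_post (c := d + 19 * es.length + 7) ?_).mono
    (c := d + 19 * es.length + 7 + 1) (by omega) fun _ _ h => h)
  rw [Program.Post]
  refine ⟨by omega, ?_⟩
  refine Wp.seq (Wp.whileLt (I := fun s c => ∃ i ≤ es.length, ReadInv es k i s ∧
    d + 15 * (es.length - i) + 4 * es.length + 7 ≤ c) ?_ ?_
    ⟨0, by omega, readInv_input es k, by omega⟩)
  · rintro s c ⟨i, hi, hI, hc⟩ hlt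
    rw [hI.reg_index, hI.reg_m] at hlt
    refine ⟨c - 1, by omega, (Wp.of_post (c := c - 15) ?_).mono (by omega) fun _ _ h => h⟩
    exact readStep_post hes hB hI hlt fun s' hI' => ⟨i + 1, by omega, hI', by omega⟩
  · rintro s c ⟨i, hi, hI, hc⟩ hlt
    rw [hI.reg_index, hI.reg_m] at hlt
    obtain rfl : i = es.length := by omega
    refine ⟨c - 1, by omega, ?_⟩
    have hidle := hI.idle hes
    refine Wp.seq ((Wp.of_post (c := c - 3) ?_).mono (c := c - 3 + 2) (by omega) fun _ _ h => h)
    simp only [Program.Post]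
    refine ⟨by omega, by omega, ?_⟩
    refine Wp.whileLt (I := fun s' c' => Idle G es k s' ∧ s'.reg 17 = s'.reg 5 * s'.reg 5 ∧
      s'.reg 8 = 0 ∧ 1 ≤ s'.reg 5 ∧
      (s'.reg 5 = 1 ∨ (s'.reg 5 - 1) * (s'.reg 5 - 1) < es.length) ∧
      d + 3 * (es.length + 1 - s'.reg 5) + 1 ≤ c') ?_ ?_ ?_
    · rintro s' c' ⟨hI, h17, h8, h1, hL, hc'⟩ hlt
      rw [h17, hI.ready.reg_m] at hlt
      have hle := Nat.le_mul_self (s'.reg 5)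
      have hm := Nat.le_mul_self (es.length + 1)
      have hsq : (s'.reg 5 + 1) * (s'.reg 5 + 1) ≤ (es.length + 1) * (es.length + 1) :=
        Nat.mul_le_mul (by omega) (by omega)
      refine ⟨c' - 1, by omega, (Wp.of_post (c := c' - 3) ?_).mono (c := c' - 3 + 2)
        (by omega) fun _ _ h => h⟩
      simp only [rootStep, Program.Post, State.setReg_reg, hI.ready.reg_one]
      simp
      refine ⟨by omega, by omega, ⟨hI.ready.of_eq (by simp) (by simp), ?_, ?_, ?_, ?_⟩, h8, ?_,
        by omega⟩
      · simpa using hI.matching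
      · simpa using hI.reg_cur
      · simpa using hI.reg_stack
      · simpa using hI.price_eq_zero
      · exact .inr hlt
    · rintro s' c' ⟨hI, h17, h8, h1, hL, hc'⟩ hlt
      rw [h17, hI.ready.reg_m] at hlt
      exact ⟨d, by omega, hQ s' _ hI rfl h8 ⟨h1, by omega, hL⟩⟩
    · refine ⟨⟨hidle.ready.of_eq (by simp) (by simp), ?_, ?_, ?_, ?_⟩, ?_⟩
      · simpa using hidle.matching
      · simpa using hidle.reg_cur
      · simpa using hidle.reg_stack
      · simpa using hidle.price_eq_zero
      · simp [hI.reg_rest]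
        omega

end

/-! ### The whole program -/

section

variable {n : ℕ} {G : TwoColoredGraph (Fin n)} {es : List (Fin n × Fin n × Bool)} {B k : ℕ}

/-- Decides Bicolored `P₃` Deletion without endangered bicolored `K₃`: a first pass with price
limit `⌈√m⌉`, then passes with price limit `1` until the matching has not grown. -/
def decideBPD : Program :=
  setup ;; pass ;; .const 5 1 ;; .whileLt 3 7 pass ;; .ifLt 2 8 (.const 0 0) (.const 0 1)

/-- A bound on the number of steps of `decideBPD`. -/
def totalCost (n m L : ℕ) : ℕ :=
  19 * m + 8 + passCost n m L + 1 + (L + 1) * (passCost n m 1 + 1) + 4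

theorem decideBPD_wp (hes : G.IsEdgeList es) (hG : ∀ u v w, ¬ G.IsEndangeredK3 u v w)
    (hB : n * n + (es.length + 1) * (es.length + 1) + 1 < B) :
    ∃ L, IsCeilSqrt es.length L ∧ Wp B decideBPD
      (fun s _ => (G.IsYesInstanceBPD k → s.reg 0 = 1) ∧ (¬ G.IsYesInstanceBPD k → s.reg 0 = 0))
      (inputBPD es k) (totalCost n es.length L) := by
  have hm := Nat.le_mul_self (es.length + 1)
  obtain ⟨L, hL⟩ : ∃ L, IsCeilSqrt es.length L := IsCeilSqrt.exists _
  refine ⟨L, hL, ?_⟩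
  refine Wp.seq ((setup_wp (d := passCost n es.length L + 1 +
    (L + 1) * (passCost n es.length 1 + 1) + 4) hes hB ?_).mono (by unfold totalCost; omega)
    fun _ _ h => h)
  intro s L' h h5 h8 hL'
  obtain rfl := hL'.eq hL
  refine Wp.seq ((pass_wp (d := 1 + (L' + 1) * (passCost n es.length 1 + 1) + 4) hes hB hL.1
    hL.le_succ h h5 ?_).mono (by omega) fun _ _ h => h)
  intro s₁ h₁ hopt _ _ _ hcov
  replace hcov := hcov hL.2.1
  -- `K` bounds the size of the matching, so that at most `L + 1` passes follow: the number of
  -- augmentations that are still possible, plus one pass that proves optimality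
  generalize hK : s₁.reg 8 + L' = K at hcov
  refine Wp.seq ((Wp.of_post (c := (L' + 1) * (passCost n es.length 1 + 1) + 4) ?_).mono
    (c := (L' + 1) * (passCost n es.length 1 + 1) + 4 + 1) (by omega) fun _ _ h => h)
  rw [Program.Post]
  refine ⟨by omega, ?_⟩
  refine Wp.seq (Wp.whileLt (I := fun s c => Idle G es k s ∧ s.reg 5 = 1 ∧
    (s.reg 7 = 0 → HasCover (Conflict G es) (s.reg 8)) ∧
    (K - s.reg 8 + if s.reg 7 = 0 then 0 else 1) * (passCost n es.length 1 + 1) + 4 ≤ c) ?_ ?_ ?_)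
  · rintro s c ⟨hI, h5, -, hc⟩ hlt
    rw [hI.ready.reg_zero] at hlt
    rw [if_neg hlt.ne', Nat.succ_mul] at hc
    refine ⟨c - 1, by omega, (pass_wp (L := 1)
      (d := (K - s.reg 8) * (passCost n es.length 1 + 1) + 4) hes hB le_rfl (by omega) hI h5
      ?_).mono (by omega) fun _ _ h => h⟩
    intro s' hI' hopt hgrow hle h5' _
    refine ⟨hI', h5', hopt, ?_⟩
    have hK := hI'.matching.le_of_hasCover hcov
    refine Nat.add_le_add_right (Nat.mul_le_mul_right _ ?_) _
    split_ifs with h7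
    · omega
    · have := hgrow h7
      omega
  · rintro s c ⟨hI, h5, hopt, hc⟩ hlt
    rw [hI.ready.reg_zero] at hlt
    refine ⟨c - 1, by omega, (Wp.of_post (c := c - 3) ?_).mono (c := c - 3 + 2) (by omega)
      fun _ _ h => h⟩
    have hcover := hopt (by omega)
    have hyes : G.IsYesInstanceBPD k ↔ s.reg 8 ≤ k :=
      ⟨fun h => hI.matching.le_of_hasCover (.of_isYesInstance hes h),
        fun h => (hcover.mono h).isYesInstance hes hG⟩
    simp only [Program.Post, State.setReg_reg, hI.ready.reg_k, hyes]
    simp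
    omega
  · refine ⟨⟨h₁.ready.of_eq (by simp) (by simp), ?_, ?_, ?_, ?_⟩, by simp, by simpa using hopt, ?_⟩
    · simpa using h₁.matching
    · simpa using h₁.reg_cur
    · simpa using h₁.reg_stack
    · simpa using h₁.price_eq_zero
    · refine Nat.add_le_add_right (Nat.mul_le_mul_right _ ?_) _
      simp only [State.setReg_reg]
      simp
      split_ifs <;> omega

end

theorem passCost_le {n m L : ℕ} (hn : 1 ≤ n) (hm : 1 ≤ m) (hL : 1 ≤ L) :
    passCost n m L ≤ 259 * (n * m * L) := by
  have h2 : n * m ≤ n * m * L := Nat.le_mul_of_pos_right _ hL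
  have h3 : m ≤ n * m := Nat.le_mul_of_pos_left _ hn
  have h4 : passCost n m L ≤ 40 * (2 * n) * (2 * (m * L)) + (40 * (2 * n) + 13) * m + 6 := by
    unfold passCost
    gcongr <;> omega
  have e : 40 * (2 * n) * (2 * (m * L)) + (40 * (2 * n) + 13) * m + 6 =
      160 * (n * m * L) + 80 * (n * m) + 13 * m + 6 := by ring
  omega

/-- With `L ≤ 2 √m` the number of steps is of the order of `n m √m`; without edges it is
constant. -/
theorem totalCost_le {n m L : ℕ} (hn : m ≠ 0 → 1 ≤ n) (hL : IsCeilSqrt m L) :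
    (totalCost n m L : ℝ) ≤ 4000 * (n * (m : ℝ) ^ ((3 : ℝ) / 2) + 1) := by
  obtain ⟨h1, -, hL⟩ := hL
  rcases Nat.eq_zero_or_pos m with rfl | hm
  · obtain rfl : L = 1 := by omega
    norm_num [totalCost, passCost]
  · have hn := hn hm.ne'
    have hnat : totalCost n m L ≤ 2000 * (n * m * L) := by
      have hp := passCost_le hn hm h1
      have hp1 := passCost_le hn hm le_rfl
      rw [mul_one] at hp1
      have hnm : 1 ≤ n * m := Nat.mul_pos hn hm
      have hmul : (L + 1) * (passCost n m 1 + 1) ≤ 2 * L * (260 * (n * m)) :=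
        Nat.mul_le_mul (by omega) (by omega)
      have e : 2 * L * (260 * (n * m)) = 520 * (n * m * L) := by ring
      have h2 : n * m ≤ n * m * L := Nat.le_mul_of_pos_right _ h1
      have h3 : m ≤ n * m := Nat.le_mul_of_pos_left _ hn
      unfold totalCost
      omega
    have hsqrt : (L : ℝ) ≤ 2 * √m := by
      have h1m : (1 : ℝ) ≤ √m := Real.one_le_sqrt.2 (by exact_mod_cast hm)
      rcases hL with rfl | hL
      · push_cast; linarith
      · have : ((L - 1 : ℕ) : ℝ) ≤ √m := Real.le_sqrt_of_sq_le (by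
          rw [sq]; exact_mod_cast hL.le)
        rw [Nat.cast_sub h1] at this
        push_cast at this
        linarith
    have hpow : (m : ℝ) ^ ((3 : ℝ) / 2) = m * √m := by
      rw [Real.sqrt_eq_rpow, ← Real.rpow_one_add' (by positivity) (by norm_num)]
      norm_num
    rw [hpow]
    have : (totalCost n m L : ℝ) ≤ 2000 * (n * m * L) := by exact_mod_cast hnat
    have h2 : (n * m : ℝ) * L ≤ n * m * (2 * √m) := by gcongr
    linarith

end WordRAM

theorem mainTheorem3 :
    ∃ (p : WordRAM.Program) (c C : ℕ),
      ∀ (n k : ℕ) (G : TwoColoredGraph (Fin n)) (es : List (Fin n × Fin n × Bool)),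
        G.IsEdgeList es → (∀ u v w, ¬ G.IsEndangeredK3 u v w) →
        ∃ (t : ℕ) (s : WordRAM.State),
          WordRAM.Exec ((n + G.numEdges + k + 2) ^ c) p (WordRAM.inputBPD es k) t s ∧
          (t : ℝ) ≤ C * (n * (G.numEdges : ℝ) ^ ((3 : ℝ) / 2) + 1) ∧
          (G.IsYesInstanceBPD k → s.reg 0 = 1) ∧
          (¬ G.IsYesInstanceBPD k → s.reg 0 = 0) := by
  refine ⟨WordRAM.decideBPD, 2, 4000, fun n k G es hes hG => ?_⟩
  rw [numEdges_eq_length hes]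
  have hB : n * n + (es.length + 1) * (es.length + 1) + 1 < (n + es.length + k + 2) ^ 2 := by
    nlinarith [Nat.zero_le (n * es.length), Nat.zero_le (n * k), Nat.zero_le (es.length * k),
      Nat.zero_le (k * k)]
  have hn : es.length ≠ 0 → 1 ≤ n := fun h => by
    obtain ⟨e, -⟩ := List.exists_mem_of_length_pos (Nat.pos_of_ne_zero h)
    have := e.1.2
    omega
  obtain ⟨L, hL, t, s, c, hexec, hc, hans⟩ :=
    WordRAM.decideBPD_wp (k := k) hes hG hB
  refine ⟨t, s, hexec, le_trans ?_ (WordRAM.totalCost_le hn hL), hans⟩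
  exact_mod_cast (show t ≤ WordRAM.totalCost n es.length L by omega)
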